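/- Let $H$ be a separable complex Hilbert space, let $A=A^*\ge\lambda_0E$ with $\lambda_0>0$ be a (generally unbounded) self-adjoint operator in $H$, and let $\kappa\in\mathbb R$ and $R_+=[0,\infty)$. Let $L_{2,\kappa}(R_+;H)$ be the space of (classes of) measurable functions $f:R_+\to H$ with finite norm $\|f\|_{L_{2,\kappa}}=\big(\int_0^\infty\|f(t)\|^2e^{-\kappa t}\,dt\big)^{1/2}$. Let $W^4_{2,\kappa}(R_+;H)$ be the space of functions $u$ with $u^{(4)}\in L_{2,\kappa}(R_+;H)$ and $A^4u\in L_{2,\kappa}(R_+;H)$, with norm $\|u\|_{W^4_{2,\kappa}}=\big(\|u^{(4)}\|^2_{L_{2,\kappa}}+\|A^4u\|^2_{L_{2,\kappa}}\big)^{1/2}$, where derivatives are taken in the sense of distributions on $(0,\infty)$. Let $\mathring W^4_{2,\kappa}(R_+;H)$ be its subspace defined by $u(0)=u'(0)=u''(0)=0$ (the continuous representatives of $u,u',u''$ vanish at $0$). Let $A_1,\dots,A_4$ be linear, generally unbounded, operators in $H$ such that $A_jA^{-j}$, $j=1,2,3,4$, are everywhere defined bounded operators in $H$. Then $$P_1u(t)=\sum_{j=1}^4A_j\,u^{(4-j)}(t)$$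 is well defined for every $u\in\mathring W^4_{2,\kappa}(R_+;H)$ and almost every $t\in R_+$ (that is, $u,u',u'',u'''$ are functions and $u^{(4-j)}(t)\in D(A_j)$ for almost every $t$), and $P_1$ is a bounded linear operator from $\mathring W^4_{2,\kappa}(R_+;H)$ into $L_{2,\kappa}(R_+;H)$: there is a constant $C$ with $\|P_1u\|_{L_{2,\kappa}}\le C\|u\|_{W^4_{2,\kappa}}$ for all $u\in\mathring W^4_{2,\kappa}(R_+;H)$. -/

import Mathlib

open MeasureTheory Set
open scoped ContDiff

noncomputable section

namespace WeightedSobolev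

section Operators

variable {H : Type*} [NormedAddCommGroup H] [InnerProductSpace ℂ H]

/-- Composition `g ∘ f` of partially defined operators on its natural domain
`{x ∈ D(f) | f x ∈ D(g)}`. -/
def opComp (g f : H →ₗ.[ℂ] H) : H →ₗ.[ℂ] H :=
  g.comp (f.domRestrict ((g.domain.comap f.toFun).map f.domain.subtype)) (by
    rintro ⟨x, ⟨y, hy, hyx⟩, hxf⟩
    have h : y = ⟨x, hxf⟩ := Subtype.ext hyx
    subst h
    exact hy)

/-- The powers `A ^ n` of a partially defined operator, on their natural domains. -/
def opPow (A : H →ₗ.[ℂ] H) : ℕ → (H →ₗ.[ℂ] H)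
  | 0 => (LinearMap.id : H →ₗ[ℂ] H).toPMap ⊤
  | n + 1 => opComp (opPow A n) A

/-- A partially defined operator is bounded in `H`: it is defined on all of `H` and satisfies a
norm bound. -/
def IsBoundedIn (T : H →ₗ.[ℂ] H) : Prop :=
  T.domain = ⊤ ∧ ∃ C : ℝ, ∀ x : T.domain, ‖T x‖ ≤ C * ‖(x : H)‖

theorem mem_graph_opComp (g f : H →ₗ.[ℂ] H) (x z : H) :
    (x, z) ∈ (opComp g f).graph ↔ ∃ y, (x, y) ∈ f.graph ∧ (y, z) ∈ g.graph := by
  simp only [LinearPMap.mem_graph_iff]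
  constructor
  · rintro ⟨⟨a, ⟨⟨b, hb, hba⟩, haf⟩⟩, hax, haz⟩
    simp only at hax
    subst hax
    exact ⟨f ⟨a, haf⟩, ⟨⟨a, haf⟩, rfl, rfl⟩, ⟨⟨f ⟨a, haf⟩, by
      have : b = ⟨a, haf⟩ := Subtype.ext hba
      subst this; exact hb⟩, rfl, haz⟩⟩
  · rintro ⟨y, ⟨a, rfl, rfl⟩, ⟨b, hb, rfl⟩⟩
    refine ⟨⟨a, ⟨a, ?_, rfl⟩, a.2⟩, rfl, ?_⟩
    · change f a ∈ g.domain
      rw [← hb]; exact b.2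
    · exact congrArg g (Subtype.ext hb.symm)

end Operators

section Spaces

variable {H : Type*} [NormedAddCommGroup H] [InnerProductSpace ℂ H]

/-- The measure `e^{-κ t} dt` on `R₊ = [0, ∞)`. -/
def weightedMeasure (κ : ℝ) : Measure ℝ :=
  (volume.restrict (Ici (0 : ℝ))).withDensity fun t => ENNReal.ofReal (Real.exp (-κ * t))

theorem ae_weightedMeasure (κ : ℝ) :
    ae (weightedMeasure κ) = ae (volume.restrict (Ioi (0 : ℝ))) := by
  rw [restrict_Ioi_eq_restrict_Ici]
  apply le_antisymm
  · exact (withDensity_absolutelyContinuous _ _).ae_le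
  · refine (withDensity_absolutelyContinuous' ?_ ?_).ae_le
    · fun_prop
    · exact ae_of_all _ fun t => (ENNReal.ofReal_pos.mpr (Real.exp_pos _)).ne'

variable (H) in
/-- `L_{2,κ}(R₊; H)`, with norm `(∫₀^∞ ‖f(t)‖² e^{-κ t} dt)^{1/2}`. -/
abbrev L2w (κ : ℝ) : Type _ := Lp H 2 (weightedMeasure κ)

/-- `v` is the derivative of order `k` of `u` on `(0, ∞)` in the sense of distributions, both being
locally integrable there. (The test functions vanish outside `(0, ∞)`, so the values of `u` and `v`
outside `(0, ∞)` play no role.) -/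
structure HasWeakDeriv (k : ℕ) (u v : ℝ → H) : Prop where
  left : LocallyIntegrableOn u (Ioi 0)
  right : LocallyIntegrableOn v (Ioi 0)
  eq : ∀ φ : ℝ → ℝ, ContDiff ℝ ∞ φ → HasCompactSupport φ → tsupport φ ⊆ Ioi 0 →
    ∫ t, iteratedDeriv k φ t • u t = (-1 : ℝ) ^ k • ∫ t, φ t • v t

theorem integrable_test_smul {u : ℝ → H} (hu : LocallyIntegrableOn u (Ioi 0)) {φ : ℝ → ℝ}
    (hφ : Continuous φ) (hc : HasCompactSupport φ) (hs : tsupport φ ⊆ Ioi 0) :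
    Integrable fun t => φ t • u t := by
  have h1 : IntegrableOn u (tsupport φ) := hu.integrableOn_compact_subset hs hc
  have h2 : IntegrableOn (fun t => φ t • u t) (tsupport φ) :=
    h1.continuousOn_smul hφ.continuousOn hc
  refine (integrableOn_iff_integrable_of_support_subset ?_).mp h2
  intro t ht
  apply subset_tsupport φ
  intro h0
  exact ht (by simp [h0])

theorem integrable_iteratedDeriv_smul {u : ℝ → H} (hu : LocallyIntegrableOn u (Ioi 0)) {φ : ℝ → ℝ}
    (k : ℕ) (hφ : ContDiff ℝ ∞ φ) (hc : HasCompactSupport φ) (hs : tsupport φ ⊆ Ioi 0) :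
    Integrable fun t => iteratedDeriv k φ t • u t := by
  have hsub : tsupport (iteratedDeriv k φ) ⊆ tsupport φ := by
    apply closure_minimal _ (isClosed_tsupport φ)
    intro t ht
    apply support_iteratedFDeriv_subset (𝕜 := ℝ) k
    intro h0
    exact ht (by simp [iteratedDeriv, h0])
  refine integrable_test_smul hu (hφ.continuous_iteratedDeriv k (by exact_mod_cast le_top)) ?_
    (hsub.trans hs)
  exact hc.of_isClosed_subset (isClosed_tsupport _) hsub

theorem HasWeakDeriv.zero (k : ℕ) : HasWeakDeriv k (0 : ℝ → H) 0 :=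
  ⟨locallyIntegrableOn_zero, locallyIntegrableOn_zero, by simp⟩

theorem HasWeakDeriv.add {k : ℕ} {u u' v v' : ℝ → H} (h : HasWeakDeriv k u v)
    (h' : HasWeakDeriv k u' v') : HasWeakDeriv k (u + u') (v + v') := by
  refine ⟨h.left.add h'.left, h.right.add h'.right, fun φ hφ hc hs => ?_⟩
  simp only [Pi.add_apply, smul_add]
  rw [integral_add (integrable_iteratedDeriv_smul h.left k hφ hc hs)
    (integrable_iteratedDeriv_smul h'.left k hφ hc hs),
    integral_add (integrable_test_smul h.right hφ.continuous hc hs)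
    (integrable_test_smul h'.right hφ.continuous hc hs), h.eq φ hφ hc hs, h'.eq φ hφ hc hs,
    smul_add]

theorem HasWeakDeriv.smul {k : ℕ} {u v : ℝ → H} (c : ℂ) (h : HasWeakDeriv k u v) :
    HasWeakDeriv k (c • u) (c • v) := by
  refine ⟨h.left.smul c, h.right.smul c, fun φ hφ hc hs => ?_⟩
  simp only [Pi.smul_apply]
  simp_rw [fun (r : ℝ) (x : H) => smul_comm r c x]
  rw [integral_smul, integral_smul, h.eq φ hφ hc hs, smul_comm]

theorem HasWeakDeriv.congr {k : ℕ} {u u' v v' : ℝ → H} (h : HasWeakDeriv k u v)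
    (hu : u =ᵐ[volume.restrict (Ioi 0)] u') (hv : v =ᵐ[volume.restrict (Ioi 0)] v') :
    HasWeakDeriv k u' v' := by
  have key : ∀ {w w' : ℝ → H}, w =ᵐ[volume.restrict (Ioi 0)] w' →
      LocallyIntegrableOn w (Ioi 0) → LocallyIntegrableOn w' (Ioi 0) := by
    intro w w' hw hl
    rw [locallyIntegrableOn_iff isOpen_Ioi.isLocallyClosed] at hl ⊢
    intro K hK hKc
    exact (hl K hK hKc).congr (ae_mono (Measure.restrict_mono hK le_rfl) hw)
  have int : ∀ {w w' : ℝ → H} {ψ : ℝ → ℝ}, w =ᵐ[volume.restrict (Ioi 0)] w' →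
      (∀ t, t ∉ Ioi (0 : ℝ) → ψ t = 0) → ∫ t, ψ t • w t = ∫ t, ψ t • w' t := by
    intro w w' ψ hw hψ
    rw [Filter.EventuallyEq, ae_restrict_iff' measurableSet_Ioi] at hw
    apply integral_congr_ae
    filter_upwards [hw] with t ht
    by_cases h0 : t ∈ Ioi (0 : ℝ)
    · rw [ht h0]
    · simp [hψ t h0]
  refine ⟨key hu h.left, key hv h.right, fun φ hφ hc hs => ?_⟩
  rw [← int hu, ← int hv, h.eq φ hφ hc hs]
  · intro t ht
    exact image_eq_zero_of_notMem_tsupport fun h1 => ht (hs h1)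
  · intro t ht
    by_contra h0
    refine ht (hs (support_iteratedFDeriv_subset (𝕜 := ℝ) k ?_))
    intro h1
    exact h0 (by simp [iteratedDeriv, h1])

/-- Distributional derivatives are unique. -/
theorem HasWeakDeriv.unique [CompleteSpace H] {k : ℕ} {u v v' : ℝ → H} (h : HasWeakDeriv k u v)
    (h' : HasWeakDeriv k u v') : v =ᵐ[volume.restrict (Ioi 0)] v' := by
  have := isOpen_Ioi.ae_eq_zero_of_integral_contDiff_smul_eq_zero (μ := volume)
    (h.right.sub h'.right) (fun φ hφ hc hs => by
      simp only [Pi.sub_apply, smul_sub]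
      rw [integral_sub (integrable_test_smul h.right hφ.continuous hc hs)
        (integrable_test_smul h'.right hφ.continuous hc hs), sub_eq_zero]
      have := (h.eq φ hφ hc hs).symm.trans (h'.eq φ hφ hc hs)
      exact smul_right_injective H (pow_ne_zero k (by norm_num : (-1 : ℝ) ≠ 0)) this)
  rw [Filter.EventuallyEq, ae_restrict_iff' measurableSet_Ioi]
  filter_upwards [this] with t ht h0
  exact sub_eq_zero.mp (ht h0)

/-- `W^4_{2,κ}(R₊; H)`: the functions `u` with `u'''' ∈ L_{2,κ}` (distributional derivative) and
`A⁴ u ∈ L_{2,κ}`. As `A` is boundedly invertible, such a `u` lies in `L_{2,κ}` itself. -/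
def W4 (A : H →ₗ.[ℂ] H) (κ : ℝ) : Submodule ℂ (L2w H κ) where
  carrier := {u | (∃ v : L2w H κ, HasWeakDeriv 4 u v) ∧
    ∃ w : L2w H κ, ∀ᵐ t ∂(weightedMeasure κ), (u t, w t) ∈ (opPow A 4).graph}
  zero_mem' := by
    have h0 : ((0 : L2w H κ) : ℝ → H) =ᵐ[weightedMeasure κ] 0 := Lp.coeFn_zero _ _ _
    refine ⟨⟨0, (HasWeakDeriv.zero 4).congr ?_ ?_⟩, 0, ?_⟩
    · rw [Filter.EventuallyEq, ← ae_weightedMeasure κ]; exact h0.symm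
    · rw [Filter.EventuallyEq, ← ae_weightedMeasure κ]; exact h0.symm
    · filter_upwards [h0] with t ht
      rw [ht]
      exact (opPow A 4).graph.zero_mem
  add_mem' := by
    rintro u u' ⟨⟨v, hv⟩, w, hw⟩ ⟨⟨v', hv'⟩, w', hw'⟩
    refine ⟨⟨v + v', (hv.add hv').congr ?_ ?_⟩, w + w', ?_⟩
    · rw [Filter.EventuallyEq, ← ae_weightedMeasure κ]; exact (Lp.coeFn_add u u').symm
    · rw [Filter.EventuallyEq, ← ae_weightedMeasure κ]; exact (Lp.coeFn_add v v').symm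
    · filter_upwards [hw, hw', Lp.coeFn_add u u', Lp.coeFn_add w w'] with t h1 h2 h3 h4
      rw [h3, h4]
      exact (opPow A 4).graph.add_mem h1 h2
  smul_mem' := by
    rintro c u ⟨⟨v, hv⟩, w, hw⟩
    refine ⟨⟨c • v, (hv.smul c).congr ?_ ?_⟩, c • w, ?_⟩
    · rw [Filter.EventuallyEq, ← ae_weightedMeasure κ]; exact (Lp.coeFn_smul c u).symm
    · rw [Filter.EventuallyEq, ← ae_weightedMeasure κ]; exact (Lp.coeFn_smul c v).symm
    · filter_upwards [hw, Lp.coeFn_smul c u, Lp.coeFn_smul c w] with t h1 h3 h4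
      rw [h3, h4]
      exact (opPow A 4).graph.smul_mem c h1

/-- `u^{(s)}(0) = 0`: the derivative of order `s` of `u` has a representative that is continuous on
`[0, ∞)` and vanishes at `0`. -/
def HasZeroTrace (s : ℕ) (u : ℝ → H) : Prop :=
  ∃ g : ℝ → H, HasWeakDeriv s u g ∧ ContinuousOn g (Ici 0) ∧ g 0 = 0

/-- The subspace of `W^4_{2,κ}(R₊; H)` given by `u(0) = u'(0) = u''(0) = 0`. -/
def W4Zero (A : H →ₗ.[ℂ] H) (κ : ℝ) : Submodule ℂ (L2w H κ) where
  carrier := {u | u ∈ W4 A κ ∧ ∀ s < 3, HasZeroTrace s u}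
  zero_mem' := by
    refine ⟨zero_mem _, fun s _ => ⟨0, (HasWeakDeriv.zero s).congr ?_ (ae_eq_refl _),
      continuousOn_const, rfl⟩⟩
    rw [Filter.EventuallyEq, ← ae_weightedMeasure κ]; exact (Lp.coeFn_zero _ _ _).symm
  add_mem' := by
    rintro u u' ⟨hu, h⟩ ⟨hu', h'⟩
    refine ⟨add_mem hu hu', fun s hs => ?_⟩
    obtain ⟨g, hg, hgc, hg0⟩ := h s hs
    obtain ⟨g', hg', hgc', hg0'⟩ := h' s hs
    refine ⟨g + g', (hg.add hg').congr ?_ (ae_eq_refl _), hgc.add hgc', by simp [hg0, hg0']⟩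
    rw [Filter.EventuallyEq, ← ae_weightedMeasure κ]; exact (Lp.coeFn_add u u').symm
  smul_mem' := by
    rintro c u ⟨hu, h⟩
    refine ⟨Submodule.smul_mem _ c hu, fun s hs => ?_⟩
    obtain ⟨g, hg, hgc, hg0⟩ := h s hs
    refine ⟨c • g, (hg.smul c).congr ?_ (ae_eq_refl _), hgc.const_smul c, by simp [hg0]⟩
    rw [Filter.EventuallyEq, ← ae_weightedMeasure κ]; exact (Lp.coeFn_smul c u).symm

/-- The fourth derivative of `u ∈ W^4_{2,κ}`, as an element of `L_{2,κ}`. -/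
def deriv4 {A : H →ₗ.[ℂ] H} {κ : ℝ} (u : W4 A κ) : L2w H κ := u.2.1.choose

/-- `A⁴ u` for `u ∈ W^4_{2,κ}`, as an element of `L_{2,κ}`. -/
def pow4 {A : H →ₗ.[ℂ] H} {κ : ℝ} (u : W4 A κ) : L2w H κ := u.2.2.choose

theorem deriv4_eq [CompleteSpace H] {A : H →ₗ.[ℂ] H} {κ : ℝ} (u : W4 A κ) (v : L2w H κ)
    (hv : HasWeakDeriv 4 (u : L2w H κ) v) : deriv4 u = v := by
  apply Lp.ext
  rw [Filter.EventuallyEq, ae_weightedMeasure κ]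
  exact HasWeakDeriv.unique u.2.1.choose_spec hv

theorem pow4_eq {A : H →ₗ.[ℂ] H} {κ : ℝ} (u : W4 A κ) (w : L2w H κ)
    (hw : ∀ᵐ t ∂(weightedMeasure κ), ((u : L2w H κ) t, w t) ∈ (opPow A 4).graph) :
    pow4 u = w := by
  apply Lp.ext
  filter_upwards [u.2.2.choose_spec, hw] with t h1 h2
  exact LinearPMap.mem_graph_snd_inj _ h1 h2 rfl

/-- The norm `(‖u''''‖² + ‖A⁴ u‖²)^{1/2}` of `W^4_{2,κ}(R₊; H)`, with `L_{2,κ}` norms on the right. -/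
def W4norm {A : H →ₗ.[ℂ] H} {κ : ℝ} (u : W4 A κ) : ℝ :=
  Real.sqrt (‖deriv4 u‖ ^ 2 + ‖pow4 u‖ ^ 2)

/-- `f(t) = ∑_{j=1}^4 A_j u^{(4-j)}(t)` for almost every `t ∈ R₊`, where the distributional
derivatives `u^{(k)}`, `k ≤ 3`, are functions and `u^{(4-j)}(t)` lies in the domain of `A_j` for
almost every `t`. -/
def IsPerturbation (B : ℕ → (H →ₗ.[ℂ] H)) (κ : ℝ) (u f : ℝ → H) : Prop :=
  ∃ d : ℕ → ℝ → H, (∀ k < 4, HasWeakDeriv k u (d k)) ∧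
    ∀ᵐ t ∂(weightedMeasure κ), ∃ y : ℕ → H,
      (∀ j ∈ Finset.Icc 1 4, (d (4 - j) t, y j) ∈ (B j).graph) ∧
      f t = ∑ j ∈ Finset.Icc 1 4, y j

end Spaces

end WeightedSobolev

end

/-!
The inverse `T = A⁻¹` is a bounded positive operator, so the claim is that each `u^{(4-j)}` is of
the form `T ^ j y` with `y` in the weighted space, for then `A_j u^{(4-j)} = (A_j A^{-j}) y`. If
`A` is replaced by the bounded operator `(T + ε)⁻¹`, integration by parts, whose boundary terms
vanish because of the zero traces, and the Cauchy–Schwarz inequality bound the square of `a k =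
‖(T + ε)^{-(4-k)} u^{(k)}‖` by `a (k-1)` times `a (k+1) + K * a k`. Such a nearly log-convex
sequence is bounded by its two end terms, which are at most `‖A ^ 4 u‖` and `‖u^{(4)}‖`. As the
bounds are uniform in `ε`, they pass to the limit by duality.

For the integrations by parts one has to know that the intermediate derivatives are themselves in
the weighted space. A primitive multiplied by a smooth cut-off is controlled on unit intervals by
`u` and its derivative of top order, and the weight varies by a bounded factor on such intervals.
-/

noncomputable section

namespace WeightedSobolev

section Banach

variable {𝕜 E F : Type*} [NontriviallyNormedField 𝕜] [NormedAddCommGroup E] [NormedSpace 𝕜 E]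
  [NormedAddCommGroup F] [NormedSpace 𝕜 F]

/-- The bounded operator `T` is the inverse `A⁻¹` of the partially defined operator `A`. -/
def IsBoundedInverse (A : E →ₗ.[𝕜] F) (T : F →L[𝕜] E) : Prop :=
  ∀ x y, (x, y) ∈ A.graph ↔ T y = x

theorem IsBoundedInverse.injective {A : E →ₗ.[𝕜] F} {T : F →L[𝕜] E} (hT : IsBoundedInverse A T) :
    Function.Injective T := fun y y' h =>
  LinearPMap.mem_graph_snd_inj A ((hT _ y).mpr rfl) ((hT _ y').mpr rfl) h

theorem isClosed_range_of_norm_le_mul_norm [CompleteSpace E] [CompleteSpace F] {A : E →ₗ.[𝕜] F}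
    (hA : A.IsClosed) {c : ℝ} (hc : ∀ x : A.domain, ‖(x : E)‖ ≤ c * ‖A x‖) :
    IsClosed (A.toFun.range : Set F) := by
  have : CompleteSpace A.graph := (show IsClosed (A.graph : Set (E × F)) from hA).completeSpace_coe
  let S : A.graph →L[𝕜] F := ContinuousLinearMap.snd 𝕜 E F ∘L A.graph.subtypeL
  have hS : AntilipschitzWith (max c 1).toNNReal S := by
    refine AddMonoidHomClass.antilipschitz_of_bound S ?_
    rintro ⟨⟨x, y⟩, hxy⟩
    obtain ⟨a, rfl, rfl⟩ := (LinearPMap.mem_graph_iff A).mp hxy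
    rw [Real.coe_toNNReal _ (by positivity)]
    refine max_le ((hc a).trans ?_) ?_
    · exact mul_le_mul_of_nonneg_right (le_max_left _ _) (norm_nonneg _)
    · exact le_mul_of_one_le_left (norm_nonneg _) (le_max_right _ _)
  have hrange : (A.toFun.range : Set F) = range S := by
    rw [← LinearPMap.graph_map_snd_eq_range, Submodule.map_coe]
    exact image_eq_range _ _
  rw [hrange]
  exact hS.isClosed_range S.uniformContinuous

theorem exists_isBoundedInverse [CompleteSpace E] [CompleteSpace F] {A : E →ₗ.[𝕜] F}
    (hA : A.IsClosed) (hker : A.toFun.ker = ⊥) (hrange : A.toFun.range = ⊤) :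
    ∃ T : F →L[𝕜] E, IsBoundedInverse A T := by
  have : CompleteSpace A.graph := (show IsClosed (A.graph : Set (E × F)) from hA).completeSpace_coe
  let S : A.graph →L[𝕜] F := ContinuousLinearMap.snd 𝕜 E F ∘L A.graph.subtypeL
  have hSker : S.ker = ⊥ := by
    rw [LinearMap.ker_eq_bot']
    rintro ⟨⟨x, y⟩, hxy⟩ (rfl : y = 0)
    obtain ⟨a, rfl, ha⟩ := (LinearPMap.mem_graph_iff A).mp hxy
    obtain rfl := LinearMap.ker_eq_bot'.mp hker a ha
    rfl
  have hSrange : S.range = ⊤ := by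
    rw [LinearMap.range_eq_top] at hrange ⊢
    intro y
    obtain ⟨a, rfl⟩ := hrange y
    exact ⟨⟨_, A.mem_graph a⟩, rfl⟩
  let e := ContinuousLinearEquiv.ofBijective S hSker hSrange
  refine ⟨ContinuousLinearMap.fst 𝕜 E F ∘L A.graph.subtypeL ∘L e.symm, fun x y => ⟨fun h => ?_, ?_⟩⟩
  · have : e.symm y = ⟨(x, y), h⟩ := e.symm_apply_eq.mpr rfl
    simp [this]
  · rintro rfl
    have hy : (e.symm y : E × F).2 = y := e.apply_symm_apply y
    have hmem : ((e.symm y : E × F).1, (e.symm y : E × F).2) ∈ A.graph := (e.symm y).2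
    rwa [hy] at hmem

end Banach

section SelfAdjoint

variable {𝕜 E : Type*} [RCLike 𝕜] [NormedAddCommGroup E] [InnerProductSpace 𝕜 E]
  {A : E →ₗ.[𝕜] E} {lam : ℝ}

theorem norm_le_inv_mul_norm_of_coercive (hlam : 0 < lam)
    (hpos : ∀ x : A.domain, lam * ‖(x : E)‖ ^ 2 ≤ RCLike.re (inner 𝕜 (A x) (x : E)))
    (x : A.domain) : ‖(x : E)‖ ≤ lam⁻¹ * ‖A x‖ := by
  have h : lam * ‖(x : E)‖ ^ 2 ≤ ‖A x‖ * ‖(x : E)‖ :=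
    (hpos x).trans ((RCLike.re_le_norm _).trans (norm_inner_le_norm _ _))
  rw [inv_mul_eq_div, le_div_iff₀ hlam]
  rcases (norm_nonneg (x : E)).eq_or_lt with h0 | h0
  · simp [← h0]
  · exact le_of_mul_le_mul_right (by linarith) h0

variable [CompleteSpace E]

theorem inner_apply_left_of_isSelfAdjoint (hA : IsSelfAdjoint A) (x y : A.domain) :
    inner 𝕜 (A x) (y : E) = inner 𝕜 (x : E) (A y) := by
  have h := A.adjoint_isFormalAdjoint hA.dense_domain
  rw [LinearPMap.isSelfAdjoint_def.mp hA] at h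
  exact h x y

theorem orthogonal_range_eq_bot_of_isSelfAdjoint (hA : IsSelfAdjoint A) (hker : A.toFun.ker = ⊥) :
    A.toFun.rangeᗮ = ⊥ := by
  rw [Submodule.eq_bot_iff]
  intro y hy
  have hy' : ∀ x : A.domain, inner 𝕜 y (A x) = 0 := fun x =>
    Submodule.inner_left_of_mem_orthogonal (LinearMap.mem_range_self A.toFun x) hy
  have hyd : y ∈ A.domain := by
    have := A.mem_adjoint_domain_of_exists y ⟨0, fun x => by rw [hy' x, inner_zero_left]⟩
    rwa [LinearPMap.isSelfAdjoint_def.mp hA] at this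
  have hAy : A ⟨y, hyd⟩ = 0 := by
    refine hA.dense_domain.eq_zero_of_inner_left (𝕜 := 𝕜) fun x hx => ?_
    rw [inner_apply_left_of_isSelfAdjoint hA ⟨y, hyd⟩ ⟨x, hx⟩, hy']
  exact congrArg Subtype.val (LinearMap.ker_eq_bot'.mp hker _ hAy)

theorem exists_isBoundedInverse_of_coercive (hA : IsSelfAdjoint A) (hlam : 0 < lam)
    (hpos : ∀ x : A.domain, lam * ‖(x : E)‖ ^ 2 ≤ RCLike.re (inner 𝕜 (A x) (x : E))) :
    ∃ T : E →L[𝕜] E, IsBoundedInverse A T := by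
  have hbound := norm_le_inv_mul_norm_of_coercive hlam hpos
  have hker : A.toFun.ker = ⊥ := by
    refine LinearMap.ker_eq_bot'.mpr fun x hx => Subtype.ext (norm_le_zero_iff.mp ?_)
    exact (hbound x).trans_eq (by rw [show A x = 0 from hx, norm_zero, mul_zero])
  have : CompleteSpace A.toFun.range :=
    (isClosed_range_of_norm_le_mul_norm hA.isClosed hbound).completeSpace_coe
  exact exists_isBoundedInverse hA.isClosed hker
    (Submodule.orthogonal_eq_bot_iff.mp (orthogonal_range_eq_bot_of_isSelfAdjoint hA hker))

theorem IsBoundedInverse.isPositive {T : E →L[𝕜] E} (hT : IsBoundedInverse A T)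
    (hA : IsSelfAdjoint A) (hpos : ∀ x : A.domain, 0 ≤ RCLike.re (inner 𝕜 (A x) (x : E))) :
    T.IsPositive := by
  have hTA : ∀ y, ∃ a : A.domain, (a : E) = T y ∧ A a = y := fun y =>
    (LinearPMap.mem_graph_iff A).mp ((hT (T y) y).mpr rfl)
  refine ContinuousLinearMap.isPositive_def.mpr ⟨fun x y => ?_, fun x => ?_⟩
  · obtain ⟨a, ha, rfl⟩ := hTA x
    obtain ⟨b, hb, rfl⟩ := hTA y
    change inner 𝕜 (T (A a)) (A b) = inner 𝕜 (A a) (T (A b))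
    rw [← ha, ← hb, inner_apply_left_of_isSelfAdjoint hA]
  · obtain ⟨a, ha, rfl⟩ := hTA x
    rw [ContinuousLinearMap.reApplyInnerSelf_apply, ← ha, inner_re_symm]
    exact hpos a

end SelfAdjoint

section Powers

variable {H : Type*} [NormedAddCommGroup H] [InnerProductSpace ℂ H] {A : H →ₗ.[ℂ] H} {T : H →L[ℂ] H}

theorem IsBoundedInverse.pow (hT : IsBoundedInverse A T) (n : ℕ) :
    IsBoundedInverse (opPow A n) (T ^ n) := by
  induction n with
  | zero =>
    intro x y
    simp only [opPow, LinearPMap.mem_graph_iff, pow_zero, one_apply_eq_self]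
    exact ⟨fun ⟨a, ha, hay⟩ => hay.symm.trans ha, fun h => ⟨⟨y, trivial⟩, h, rfl⟩⟩
  | succ n ih =>
    intro x y
    rw [opPow, mem_graph_opComp, pow_succ', mul_apply_eq_comp]
    refine ⟨fun ⟨z, hxz, hzy⟩ => ?_, fun h => ⟨_, (hT _ _).mpr h, (ih _ _).mpr rfl⟩⟩
    rw [(ih z y).mp hzy, (hT x z).mp hxz]

theorem IsBoundedInverse.mem_graph_inverse_iff (hT : IsBoundedInverse A T) (x y : H) :
    (y, x) ∈ A.inverse.graph ↔ T y = x := by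
  have hker : A.toFun.ker = ⊥ := LinearMap.ker_eq_bot'.mpr fun a ha => by
    have h := (hT _ _).mp (A.mem_graph a)
    rw [show A a = 0 from ha, map_zero] at h
    exact Subtype.ext h.symm
  rw [LinearPMap.inverse_graph hker, ← hT]
  simp

theorem IsBoundedInverse.exists_mem_graph (hT : IsBoundedInverse A T) {B : H →ₗ.[ℂ] H}
    (hB : IsBoundedIn (opComp B A.inverse)) : ∃ Q : H →L[ℂ] H, ∀ y, (T y, Q y) ∈ B.graph := by
  obtain ⟨hdom, C, hC⟩ := hB
  set F := opComp B A.inverse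
  have hmem : ∀ y, y ∈ F.domain := fun y => hdom ▸ Submodule.mem_top
  let Q : H →L[ℂ] H := LinearMap.mkContinuous
    (F.toFun ∘ₗ LinearMap.codRestrict F.domain LinearMap.id hmem) C fun y => hC ⟨y, hmem y⟩
  refine ⟨Q, fun y => ?_⟩
  obtain ⟨z, hyz, hzQ⟩ := (mem_graph_opComp _ _ _ _).mp (F.mem_graph ⟨y, hmem y⟩)
  rwa [(hT.mem_graph_inverse_iff z y).mp hyz]

end Powers

section Regularization

open Filter Topology

theorem exists_adjoint_apply_eq_of_norm_inner_le {𝕜 E F : Type*} [RCLike 𝕜] [NormedAddCommGroup E]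
    [InnerProductSpace 𝕜 E] [CompleteSpace E] [NormedAddCommGroup F] [InnerProductSpace 𝕜 F]
    [CompleteSpace F] (S : E →L[𝕜] F) {x : E} {M : ℝ} (hM : 0 ≤ M)
    (h : ∀ z, ‖inner 𝕜 x z‖ ≤ M * ‖S z‖) : ∃ y, S.adjoint y = x ∧ ‖y‖ ≤ M := by
  obtain ⟨R, hR⟩ := S.toLinearMap.rangeRestrict.exists_rightInverse_of_surjective
    S.toLinearMap.range_rangeRestrict
  have hSR : ∀ p, S (R p) = p := fun p => congrArg Subtype.val (LinearMap.congr_fun hR p)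
  let ℓ : StrongDual 𝕜 S.toLinearMap.range :=
    LinearMap.mkContinuous ((innerSL 𝕜 x).toLinearMap ∘ₗ R) M fun p => by
      simpa [hSR] using h (R p)
  obtain ⟨g, hg, hgn⟩ := exists_extension_norm_eq _ ℓ
  refine ⟨(InnerProductSpace.toDual 𝕜 F).symm g, ext_inner_right 𝕜 fun z => ?_, ?_⟩
  · have hz : inner 𝕜 x (R (S.toLinearMap.rangeRestrict z) - z) = 0 := by
      have := h (R (S.toLinearMap.rangeRestrict z) - z)
      rw [map_sub, hSR] at this
      simpa using this
    rw [inner_sub_right, sub_eq_zero] at hz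
    rw [S.adjoint_inner_left, InnerProductSpace.toDual_symm_apply, ← hz]
    exact hg (S.toLinearMap.rangeRestrict z)
  · rw [LinearIsometryEquiv.norm_map, hgn]
    exact LinearMap.mkContinuous_norm_le _ hM _

variable {E : Type*} [NormedAddCommGroup E] [InnerProductSpace ℂ E]
  {T : E →L[ℂ] E} {ε : ℝ}

theorem norm_apply_le_norm_apply_add_smul (hT : 0 ≤ T) (hε : 0 ≤ ε) (x : E) :
    ‖T x‖ ≤ ‖T x + ε • x‖ := by
  refine le_of_sq_le_sq ?_ (norm_nonneg _)
  have hTx : 0 ≤ RCLike.re (inner ℂ (T x) x) :=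
    ((ContinuousLinearMap.nonneg_iff_isPositive T).mp hT).re_inner_nonneg_left x
  rw [norm_add_sq (𝕜 := ℂ), inner_smul_right_eq_smul, RCLike.smul_re]
  nlinarith [sq_nonneg ‖ε • x‖, mul_nonneg hε hTx]

variable [CompleteSpace E]

/-- The bounded substitute `(T + ε)⁻¹` for the possibly unbounded inverse of `T ≥ 0`. -/
def regInverse (T : E →L[ℂ] E) (ε : ℝ) : E →L[ℂ] E :=
  Ring.inverse (T + algebraMap ℝ (E →L[ℂ] E) ε)

theorem isStrictlyPositive_add_algebraMap (hT : 0 ≤ T) (hε : 0 < ε) :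
    IsStrictlyPositive (T + algebraMap ℝ (E →L[ℂ] E) ε) :=
  (isStrictlyPositive_algebraMap hε).nonneg_add hT

theorem isSelfAdjoint_regInverse (hT : 0 ≤ T) (hε : 0 < ε) : IsSelfAdjoint (regInverse T ε) :=
  (isStrictlyPositive_add_algebraMap hT hε).ringInverse.isSelfAdjoint

theorem map_regInverse {F Φ : Type*} [NormedAddCommGroup F] [InnerProductSpace ℂ F]
    [FunLike Φ (E →L[ℂ] E) (F →L[ℂ] F)] [AlgHomClass Φ ℂ (E →L[ℂ] E) (F →L[ℂ] F)] (φ : Φ)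
    (hT : 0 ≤ T) (hε : 0 < ε) : φ (regInverse T ε) = regInverse (φ T) ε := by
  have hunit := (isStrictlyPositive_add_algebraMap hT hε).isUnit
  rw [regInverse, regInverse, IsScalarTower.algebraMap_apply ℝ ℂ (F →L[ℂ] F),
    ← AlgHomClass.commutes φ, ← IsScalarTower.algebraMap_apply, ← map_add,
    Ring.inverse_of_isUnit hunit, Ring.inverse_of_isUnit (hunit.map φ)]
  refine Units.eq_inv_of_mul_eq_one_left ?_
  rw [IsUnit.unit_spec, ← map_mul, hunit.mul_val_inv, map_one]

theorem add_smul_regInverse_apply (hT : 0 ≤ T) (hε : 0 < ε) (x : E) :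
    T (regInverse T ε x) + ε • regInverse T ε x = x := by
  have h := Ring.mul_inverse_cancel _ (isStrictlyPositive_add_algebraMap hT hε).isUnit
  rw [Algebra.algebraMap_eq_smul_one] at h
  simpa [regInverse, Algebra.algebraMap_eq_smul_one] using congrArg (fun S : E →L[ℂ] E => S x) h

theorem commute_regInverse (hT : 0 ≤ T) (hε : 0 < ε) : Commute T (regInverse T ε) := by
  have hu := (isStrictlyPositive_add_algebraMap hT hε).isUnit
  have h : Commute T (T + algebraMap ℝ (E →L[ℂ] E) ε) :=
    (Commute.refl T).add_right (Algebra.commutes ε T).symm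
  rw [regInverse, Ring.inverse_of_isUnit hu]
  exact (show Commute T hu.unit from h).units_inv_right

theorem norm_regInverse_pow_apply_pow_apply_le (hT : 0 ≤ T) (hε : 0 < ε) (n : ℕ) (x : E) :
    ‖(regInverse T ε ^ n) ((T ^ n) x)‖ ≤ ‖x‖ := by
  have hTG : ∀ x, ‖(T * regInverse T ε) x‖ ≤ ‖x‖ := fun x =>
    (norm_apply_le_norm_apply_add_smul hT hε.le _).trans_eq
      (congrArg norm (add_smul_regInverse_apply hT hε x))
  rw [← mul_apply_eq_comp, ← (commute_regInverse hT hε).symm.mul_pow,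
    (commute_regInverse hT hε).symm.eq]
  induction n with
  | zero => simp
  | succ n ih =>
    rw [pow_succ', mul_apply_eq_comp]
    exact (hTG _).trans ih

theorem norm_le_mul_norm_regInverse_apply (hT : 0 ≤ T) (hε : 0 < ε) (hε1 : ε ≤ 1) (x : E) :
    ‖x‖ ≤ (‖T‖ + 1) * ‖regInverse T ε x‖ :=
  calc ‖x‖ = ‖T (regInverse T ε x) + ε • regInverse T ε x‖ := by
        rw [add_smul_regInverse_apply hT hε]
    _ ≤ ‖T‖ * ‖regInverse T ε x‖ + ε * ‖regInverse T ε x‖ := by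
      refine (norm_add_le _ _).trans (add_le_add (T.le_opNorm _) ?_)
      rw [norm_smul, Real.norm_of_nonneg hε.le]
    _ ≤ (‖T‖ + 1) * ‖regInverse T ε x‖ := by
      rw [add_mul]
      gcongr

/-- As `ε → 0`, the bound `|⟪x, (T + ε)ⁿ z⟫| ≤ M ‖(T + ε)ⁿ z‖` survives, so that no convergence of
the regularizations `(T + ε)⁻ⁿ x` is needed. -/
theorem exists_pow_apply_eq_of_norm_regInverse_pow_apply_le (hT : 0 ≤ T) (n : ℕ) {x : E} {M : ℝ}
    (hM : 0 ≤ M) (h : ∀ ε : ℝ, 0 < ε → ε ≤ 1 → ‖(regInverse T ε ^ n) x‖ ≤ M) :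
    ∃ y, (T ^ n) y = x ∧ ‖y‖ ≤ M := by
  suffices hbound : ∀ z, ‖inner ℂ x z‖ ≤ M * ‖(T ^ n) z‖ by
    have hTn : (T ^ n).adjoint = T ^ n :=
      ((IsSelfAdjoint.of_nonneg hT).pow n).adjoint_eq
    simpa [hTn] using exists_adjoint_apply_eq_of_norm_inner_le (T ^ n) hM hbound
  intro z
  let S : ℝ → E →L[ℂ] E := fun ε => T + algebraMap ℝ (E →L[ℂ] E) ε
  have hlim : Tendsto (fun ε => M * ‖(S ε ^ n) z‖) (𝓝[>] 0) (𝓝 (M * ‖(T ^ n) z‖)) := by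
    have hS : Continuous fun ε => S ε ^ n := by fun_prop
    have hc : Continuous fun ε => M * ‖(S ε ^ n) z‖ :=
      continuous_const.mul (hS.clm_apply continuous_const).norm
    simpa [S] using (hc.tendsto 0).mono_left nhdsWithin_le_nhds
  refine ge_of_tendsto hlim ?_
  filter_upwards [Ioc_mem_nhdsGT (zero_lt_one' ℝ)] with ε hε
  have hpos := isStrictlyPositive_add_algebraMap hT hε.1
  have hx : (S ε ^ n) ((regInverse T ε ^ n) x) = x := by
    rw [regInverse, Ring.inverse_pow, ← mul_apply_eq_comp,
      Ring.mul_inverse_cancel _ (hpos.isUnit.pow n), one_apply_eq_self]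
  calc ‖inner ℂ x z‖ = ‖inner ℂ ((regInverse T ε ^ n) x) ((S ε ^ n) z)‖ := by
        conv_lhs => rw [← hx]
        exact congrArg norm ((hpos.isSelfAdjoint.pow n).isSymmetric _ z)
    _ ≤ ‖(regInverse T ε ^ n) x‖ * ‖(S ε ^ n) z‖ := norm_inner_le_norm _ _
    _ ≤ M * ‖(S ε ^ n) z‖ := by gcongr; exact h ε hε.1 hε.2

end Regularization

section Interpolation

theorem le_of_sq_le_mul {x p q r : ℝ} (hp : 0 ≤ p) (hq : 0 ≤ q) (hr : 0 ≤ r)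
    (h : x ^ 2 ≤ p * (r + q * x)) : x ≤ (q + 1) * p + r := by
  by_contra! hx
  have hxr : r < x := lt_of_le_of_lt (by nlinarith [mul_nonneg hq hp]) hx
  have hx0 : 0 < x := lt_of_le_of_lt hr hxr
  nlinarith [mul_lt_mul_of_pos_right hx hx0, mul_le_mul_of_nonneg_left hxr.le hp,
    mul_nonneg hr hx0.le]

variable {K : ℝ} {n : ℕ} {a : ℕ → ℝ}

theorem succ_le_mul_add_of_sq_le (hK : 0 ≤ K) (ha : ∀ k, 0 ≤ a k)
    (h : ∀ k, k + 2 ≤ n → a (k + 1) ^ 2 ≤ a k * (a (k + 2) + K * a (k + 1))) {k : ℕ}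
    (hk : k + 1 ≤ n) : a (k + 1) ≤ n * (K + 1) * a k + a n := by
  suffices hsharp : ∀ m k, k + 1 + m = n → a (k + 1) ≤ m * (K + 1) * a k + a n by
    obtain ⟨m, rfl⟩ := Nat.exists_eq_add_of_le hk
    refine (hsharp m k rfl).trans ?_
    have := ha k
    gcongr
    omega
  intro m
  induction m with
  | zero => rintro k rfl; simp
  | succ m ih =>
    intro k hkm
    have hstep := ih (k + 1) (by omega)
    have := le_of_sq_le_mul (ha k) (q := m * (K + 1) + K) (by positivity) (ha n)
      ((h k (by omega)).trans (mul_le_mul_of_nonneg_left (by linarith) (ha k)))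
    push_cast
    linarith

/-- The constant with which the end terms of a nearly log-convex sequence of length `n` bound the
terms in between; `K` measures the defect in log-convexity. -/
def interpConst (n : ℕ) (K : ℝ) : ℝ := (n * (K + 1) + 1) ^ n

theorem interpConst_nonneg (n : ℕ) (hK : 0 ≤ K) : 0 ≤ interpConst n K := by
  unfold interpConst; positivity

theorem le_interpConst_mul_of_sq_le (hK : 0 ≤ K) (ha : ∀ k, 0 ≤ a k)
    (h : ∀ k, k + 2 ≤ n → a (k + 1) ^ 2 ≤ a k * (a (k + 2) + K * a (k + 1))) {k : ℕ}
    (hk : k ≤ n) : a k ≤ interpConst n K * (a 0 + a n) := by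
  have ha0 := ha 0
  have han := ha n
  set L := n * (K + 1) + 1 with hL
  have hL1 : 1 ≤ L := by rw [hL]; linarith [show 0 ≤ n * (K + 1) by positivity]
  suffices hpow : a k ≤ L ^ k * (a 0 + a n) from
    hpow.trans (mul_le_mul_of_nonneg_right (pow_le_pow_right₀ hL1 hk) (by positivity))
  induction k with
  | zero => linarith
  | succ k ih =>
    have hLk : 1 ≤ L ^ k := one_le_pow₀ hL1
    calc a (k + 1) ≤ (L - 1) * a k + a n := by
          simpa [hL] using succ_le_mul_add_of_sq_le hK ha h hk
      _ ≤ (L - 1) * (L ^ k * (a 0 + a n)) + L ^ k * (a 0 + a n) := by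
        have h1 := mul_le_mul_of_nonneg_left (ih (by omega)) (sub_nonneg.mpr hL1)
        nlinarith [mul_le_mul_of_nonneg_right hLk (add_nonneg ha0 han)]
      _ = L ^ (k + 1) * (a 0 + a n) := by ring

end Interpolation

section AbstractIntermediate

variable {E : Type*} [NormedAddCommGroup E] [InnerProductSpace ℂ E] [CompleteSpace E]

theorem norm_sq_pow_apply_le_of_energy_identity {G : E →L[ℂ] E} (hG : IsSelfAdjoint G) (m : ℕ)
    {κ : ℝ} {x y z : E}
    (h : inner ℂ y ((G ^ (2 * m + 2)) y) + inner ℂ x ((G ^ (2 * m + 2)) z) =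
      κ * inner ℂ x ((G ^ (2 * m + 2)) y)) :
    ‖(G ^ (m + 1)) y‖ ^ 2 ≤
      ‖(G ^ (m + 2)) x‖ * (‖(G ^ m) z‖ + |κ| * ‖(G ^ m) y‖) := by
  have hsplit : ∀ i j (a b : E), inner ℂ a ((G ^ (i + j)) b) = inner ℂ ((G ^ i) a) ((G ^ j) b) :=
    fun i j a b => by
      rw [pow_add, mul_apply_eq_comp]
      exact ((hG.pow i).isSymmetric a _).symm
  rw [show 2 * m + 2 = (m + 1) + (m + 1) by ring, hsplit _ _ y,
    show (m + 1) + (m + 1) = (m + 2) + m by ring, hsplit _ _ x, hsplit _ _ x, ← eq_sub_iff_add_eq,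
    inner_self_eq_norm_sq_to_K] at h
  have hnorm := congrArg norm h
  rw [norm_pow, RCLike.norm_ofReal, abs_norm] at hnorm
  calc ‖(G ^ (m + 1)) y‖ ^ 2
      = ‖κ * inner ℂ ((G ^ (m + 2)) x) ((G ^ m) y) - inner ℂ ((G ^ (m + 2)) x) ((G ^ m) z)‖ := hnorm
    _ ≤ |κ| * (‖(G ^ (m + 2)) x‖ * ‖(G ^ m) y‖) + ‖(G ^ (m + 2)) x‖ * ‖(G ^ m) z‖ := by
      refine (norm_sub_le _ _).trans ?_
      rw [norm_mul, Complex.norm_real, Real.norm_eq_abs]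
      gcongr <;> exact norm_inner_le_norm _ _
    _ = ‖(G ^ (m + 2)) x‖ * (‖(G ^ m) z‖ + |κ| * ‖(G ^ m) y‖) := by ring

theorem exists_pow_apply_eq_of_energy_identity {T : E →L[ℂ] E} (hT : 0 ≤ T) {κ : ℝ} {n : ℕ}
    {u : ℕ → E} {w : E} (hw : u 0 = (T ^ n) w)
    (hu : ∀ ε : ℝ, 0 < ε → ∀ k, k + 2 ≤ n → ∀ m,
      inner ℂ (u (k + 1)) ((regInverse T ε ^ m) (u (k + 1))) +
          inner ℂ (u k) ((regInverse T ε ^ m) (u (k + 2))) =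
        κ * inner ℂ (u k) ((regInverse T ε ^ m) (u (k + 1)))) {k : ℕ} (hk : k ≤ n) :
    ∃ y, (T ^ (n - k)) y = u k ∧ ‖y‖ ≤ interpConst n (|κ| * (‖T‖ + 1)) * (‖w‖ + ‖u n‖) := by
  have hK : 0 ≤ |κ| * (‖T‖ + 1) := by positivity
  have hC := interpConst_nonneg n hK
  refine exists_pow_apply_eq_of_norm_regInverse_pow_apply_le hT _ (by positivity)
    fun ε hε hε1 => ?_
  set G := regInverse T ε
  have hstep : ∀ k, k + 2 ≤ n → ‖(G ^ (n - (k + 1))) (u (k + 1))‖ ^ 2 ≤ ‖(G ^ (n - k)) (u k)‖ *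
      (‖(G ^ (n - (k + 2))) (u (k + 2))‖ +
        |κ| * (‖T‖ + 1) * ‖(G ^ (n - (k + 1))) (u (k + 1))‖) := by
    intro k hk
    obtain ⟨m, rfl⟩ := Nat.exists_eq_add_of_le hk
    rw [show k + 2 + m - (k + 1) = m + 1 by omega, show k + 2 + m - k = m + 2 by omega,
      Nat.add_sub_cancel_left]
    refine (norm_sq_pow_apply_le_of_energy_identity (isSelfAdjoint_regInverse hT hε) m
      (hu ε hε k (by omega) _)).trans ?_
    rw [mul_assoc, pow_succ' _ m, mul_apply_eq_comp]
    gcongr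
    exact norm_le_mul_norm_regInverse_apply hT hε hε1 _
  refine (le_interpConst_mul_of_sq_le (a := fun k => ‖(G ^ (n - k)) (u k)‖) hK
    (fun _ => norm_nonneg _) hstep hk).trans (mul_le_mul_of_nonneg_left ?_ hC)
  simp only [hw, Nat.sub_zero, Nat.sub_self, pow_zero, one_apply_eq_self]
  gcongr
  exact norm_regInverse_pow_apply_pow_apply_le hT hε n w

end AbstractIntermediate

section Primitives

variable {E F G : Type*} [NormedAddCommGroup E] [NormedSpace ℝ E]
  [NormedAddCommGroup F] [NormedSpace ℝ F] [NormedAddCommGroup G] [NormedSpace ℝ G]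

/-- `g` is a primitive of `g'`: the function `g'` is integrable on bounded intervals, and `g` is an
indefinite integral of it. This replaces absolute continuity, which for functions with values in a
general Banach space does not provide a derivative. -/
structure IsPrimitive (g g' : ℝ → F) : Prop where
  intervalIntegrable : ∀ a b, IntervalIntegrable g' volume a b
  integral_eq : ∀ a b, ∫ t in a..b, g' t = g b - g a

theorem isPrimitive_integral_add {g' : ℝ → F} (h : ∀ a b, IntervalIntegrable g' volume a b)
    (c : F) : IsPrimitive (fun t => (∫ s in (0 : ℝ)..t, g' s) + c) g' :=
  ⟨h, fun a b => by
    rw [add_sub_add_right_eq_sub, intervalIntegral.integral_interval_sub_left (h 0 b) (h 0 a)]⟩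

theorem isPrimitive_of_hasDerivAt [CompleteSpace F] {g g' : ℝ → F}
    (h : ∀ t, HasDerivAt g (g' t) t) (hc : Continuous g') : IsPrimitive g g' :=
  ⟨hc.intervalIntegrable, fun a b =>
    intervalIntegral.integral_eq_sub_of_hasDerivAt (fun t _ => h t) (hc.intervalIntegrable a b)⟩

theorem isPrimitive_of_le {g g' : ℝ → F}
    (hi : ∀ a b, a ≤ b → IntervalIntegrable g' volume a b)
    (he : ∀ a b, a ≤ b → ∫ t in a..b, g' t = g b - g a) : IsPrimitive g g' where
  intervalIntegrable a b := (le_total a b).elim (hi a b) fun h => (hi b a h).symm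
  integral_eq a b := (le_total a b).elim (he a b) fun h => by
    rw [intervalIntegral.integral_symm, he b a h, neg_sub]

theorem IsPrimitive.continuous {g g' : ℝ → F} (h : IsPrimitive g g') : Continuous g := by
  have heq : g = fun t => (∫ s in (0 : ℝ)..t, g' s) + g 0 := by
    ext t; rw [h.integral_eq, sub_add_cancel]
  rw [heq]
  exact (intervalIntegral.continuous_primitive h.intervalIntegrable 0).add continuous_const

theorem IsPrimitive.clm_comp [CompleteSpace F] [CompleteSpace G] {g g' : ℝ → F}
    (h : IsPrimitive g g') (L : F →L[ℝ] G) :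
    IsPrimitive (fun t => L (g t)) (fun t => L (g' t)) where
  intervalIntegrable a b := ⟨L.integrable_comp (h.intervalIntegrable a b).1,
    L.integrable_comp (h.intervalIntegrable a b).2⟩
  integral_eq a b := by
    rw [L.intervalIntegral_comp_comm (h.intervalIntegrable a b), h.integral_eq, map_sub]

theorem IsPrimitive.comp_add_right {g g' : ℝ → F} (h : IsPrimitive g g') (τ : ℝ) :
    IsPrimitive (fun t => g (t + τ)) (fun t => g' (t + τ)) where
  intervalIntegrable a b := by
    simpa using (h.intervalIntegrable (a + τ) (b + τ)).comp_add_right τ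
  integral_eq a b := by
    rw [intervalIntegral.integral_comp_add_right, h.integral_eq]

theorem intervalIntegrable_bilin_of_continuous_right (B : E →L[ℝ] F →L[ℝ] G) {f : ℝ → E}
    {g : ℝ → F} {a b : ℝ} (hf : IntervalIntegrable f volume a b) (hg : Continuous g) :
    IntervalIntegrable (fun t => B (f t) (g t)) volume a b := by
  obtain ⟨C, hC⟩ := (isCompact_uIcc (a := a) (b := b)).exists_bound_of_continuousOn hg.continuousOn
  rw [intervalIntegrable_iff] at hf ⊢
  refine B.integrable_of_bilin_of_bdd_right C hf hg.aestronglyMeasurable ?_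
  filter_upwards [ae_restrict_mem measurableSet_uIoc] with t ht
  exact hC t (uIoc_subset_uIcc ht)

theorem integral_indicator_prod_bilin (B : E →L[ℝ] F →L[ℝ] G) [CompleteSpace F] [CompleteSpace G]
    {f' : ℝ → E} {g g' : ℝ → F} (hg : IsPrimitive g g') {a b : ℝ} (hab : a ≤ b)
    (hf' : IntervalIntegrable f' volume a b) {D : Set (ℝ × ℝ)} (hD : MeasurableSet D)
    (hslice : ∀ t ∈ Ioc a b, (Prod.mk t ⁻¹' D ∩ Ioc a b : Set ℝ) =ᵐ[volume] Ioc a t) :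
    ∫ z, D.indicator (fun z => B (f' z.1) (g' z.2)) z
        ∂((volume.restrict (Ioc a b)).prod (volume.restrict (Ioc a b))) =
      ∫ t in a..b, B (f' t) (g t - g a) := by
  have hK : Integrable (fun z : ℝ × ℝ => B (f' z.1) (g' z.2))
      ((volume.restrict (Ioc a b)).prod (volume.restrict (Ioc a b))) :=
    hf'.1.op_fst_snd (by fun_prop) ⟨‖B‖, B.le_opNorm₂⟩ (hg.intervalIntegrable a b).1
  rw [integral_prod _ (hK.indicator hD), intervalIntegral.integral_of_le hab]
  refine setIntegral_congr_fun measurableSet_Ioc fun t ht => ?_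
  change ∫ s, (Prod.mk t ⁻¹' D).indicator (fun s => B (f' t) (g' s)) s
    ∂(volume.restrict (Ioc a b)) = _
  rw [integral_indicator (measurable_prodMk_left hD),
    Measure.restrict_restrict (measurable_prodMk_left hD), setIntegral_congr_set (hslice t ht),
    ← intervalIntegral.integral_of_le ht.1.le,
    (B (f' t)).intervalIntegral_comp_comm (hg.intervalIntegrable a t), hg.integral_eq]

/-- The square `(a, b]²` is split along its diagonal, and Fubini's theorem is applied on both
parts. -/
theorem IsPrimitive.integral_bilin_sub_add [CompleteSpace E] [CompleteSpace F] [CompleteSpace G]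
    (B : E →L[ℝ] F →L[ℝ] G) {f f' : ℝ → E} {g g' : ℝ → F} (hf : IsPrimitive f f')
    (hg : IsPrimitive g g') {a b : ℝ} (hab : a ≤ b) :
    (∫ t in a..b, B (f' t) (g t - g a)) + ∫ t in a..b, B (f t - f a) (g' t) =
      B (f b - f a) (g b - g a) := by
  set μ := volume.restrict (Ioc a b)
  let D : Set (ℝ × ℝ) := {z | z.2 ≤ z.1}
  have hD : MeasurableSet D := measurableSet_le measurable_snd measurable_fst
  let K : ℝ × ℝ → G := fun z => B (f' z.1) (g' z.2)
  have hK : Integrable K (μ.prod μ) :=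
    (hf.intervalIntegrable a b).1.op_fst_snd (by fun_prop) ⟨‖B‖, B.le_opNorm₂⟩
      (hg.intervalIntegrable a b).1
  have hlower : ∫ z, D.indicator K z ∂(μ.prod μ) = ∫ t in a..b, B (f' t) (g t - g a) :=
    integral_indicator_prod_bilin B hg hab (hf.intervalIntegrable a b) hD fun t ht => by
      change (Iic t ∩ Ioc a b : Set ℝ) =ᵐ[volume] Ioc a t
      rw [inter_comm, Ioc_inter_Iic, min_eq_right ht.2]
      exact ae_eq_refl _
  have hupper : ∫ z, Dᶜ.indicator K z ∂(μ.prod μ) = ∫ t in a..b, B (f t - f a) (g' t) := by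
    rw [← integral_prod_swap]
    refine integral_indicator_prod_bilin B.flip hf hab (hg.intervalIntegrable a b)
      (D := Prod.swap ⁻¹' Dᶜ) (measurable_swap hD.compl) fun t ht => ?_
    have hset : (Prod.mk t ⁻¹' (Prod.swap ⁻¹' Dᶜ) ∩ Ioc a b : Set ℝ) = Ioo a t := by
      ext s
      simp only [D, mem_inter_iff, mem_preimage, Prod.swap_prod_mk, mem_compl_iff, mem_ofPred_eq,
        not_le, mem_Ioc, mem_Ioo]
      exact ⟨fun h => ⟨h.2.1, h.1⟩, fun h => ⟨h.2, h.1, h.2.le.trans ht.2⟩⟩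
    rw [hset]
    exact Ioo_ae_eq_Ioc
  rw [← hlower, ← hupper, integral_indicator hD, integral_indicator hD.compl,
    integral_add_compl hD hK,
    integral_prod_bilin B (hf.intervalIntegrable a b).1 (hg.intervalIntegrable a b).1,
    ← intervalIntegral.integral_of_le hab, ← intervalIntegral.integral_of_le hab, hf.integral_eq,
    hg.integral_eq]

theorem IsPrimitive.bilin [CompleteSpace E] [CompleteSpace F] [CompleteSpace G]
    (B : E →L[ℝ] F →L[ℝ] G) {f f' : ℝ → E} {g g' : ℝ → F} (hf : IsPrimitive f f')
    (hg : IsPrimitive g g') :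
    IsPrimitive (fun t => B (f t) (g t)) (fun t => B (f' t) (g t) + B (f t) (g' t)) := by
  have hi {g : ℝ → F} (hg : Continuous g) (a b : ℝ) :
      IntervalIntegrable (fun t => B (f' t) (g t)) volume a b :=
    intervalIntegrable_bilin_of_continuous_right B (hf.intervalIntegrable a b) hg
  have hi' {f : ℝ → E} (hf : Continuous f) (a b : ℝ) :
      IntervalIntegrable (fun t => B (f t) (g' t)) volume a b :=
    intervalIntegrable_bilin_of_continuous_right B.flip (hg.intervalIntegrable a b) hf
  refine isPrimitive_of_le (fun a b _ => (hi hg.continuous a b).add (hi' hf.continuous a b))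
    fun a b hab => ?_
  have hleft : ∫ t in a..b, B (f' t) (g a) = B (f b - f a) (g a) := by
    rw [← hf.integral_eq]
    exact (B.flip (g a)).intervalIntegral_comp_comm (hf.intervalIntegrable a b)
  have hright : ∫ t in a..b, B (f a) (g' t) = B (f a) (g b - g a) := by
    rw [← hg.integral_eq, (B (f a)).intervalIntegral_comp_comm (hg.intervalIntegrable a b)]
  have hsum := IsPrimitive.integral_bilin_sub_add B hf hg hab
  simp only [map_sub, sub_apply] at hsum hleft hright
  rw [intervalIntegral.integral_sub (hi hg.continuous a b) (hi continuous_const a b),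
    intervalIntegral.integral_sub (hi' hf.continuous a b) (hi' continuous_const a b), hleft,
    hright] at hsum
  rw [intervalIntegral.integral_add (hi hg.continuous a b) (hi' hf.continuous a b),
    ← sub_eq_zero, ← sub_eq_zero.mpr hsum]
  abel

theorem IsPrimitive.smul [CompleteSpace F] {φ φ' : ℝ → ℝ} {g g' : ℝ → F} (hφ : IsPrimitive φ φ')
    (hg : IsPrimitive g g') :
    IsPrimitive (fun t => φ t • g t) (fun t => φ' t • g t + φ t • g' t) :=
  IsPrimitive.bilin (ContinuousLinearMap.lsmul ℝ ℝ) hφ hg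

theorem IsPrimitive.integral_Ioi_eq_neg [CompleteSpace F] {g g' : ℝ → F} (h : IsPrimitive g g')
    (hg : IntegrableOn g (Ioi 0)) (hg' : IntegrableOn g' (Ioi 0)) :
    ∫ t in Ioi 0, g' t = -g 0 := by
  have hlim := intervalIntegral_tendsto_integral_Ioi 0 hg' Filter.tendsto_id
  simp only [h.integral_eq, id_eq] at hlim
  have hzero : (∫ t in Ioi 0, g' t) + g 0 = 0 := by
    refine IntegrableAtFilter.eq_zero_of_tendsto ⟨Ioi 0, Filter.Ioi_mem_atTop _, hg⟩
      (fun s hs => ?_) (by simpa using hlim.add_const (g 0))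
    obtain ⟨b, hb⟩ := Filter.mem_atTop_sets.mp hs
    rw [← top_le_iff, ← Real.volume_Ici (a := b)]
    exact measure_mono hb
  exact eq_neg_of_add_eq_zero_left hzero

end Primitives

section TestFunctions

/-- The space of test functions on `(0, ∞)`, as it occurs in `HasWeakDeriv`. -/
abbrev TestFun : Type := TestFunction ⟨Ioi (0 : ℝ), isOpen_Ioi⟩ ℝ ⊤

theorem exists_Icc_of_isCompact_subset_Ioi {K : Set ℝ} (hK : IsCompact K) (h0 : K ⊆ Ioi 0) :
    ∃ a b, 0 < a ∧ a ≤ b ∧ K ⊆ Icc a b := by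
  rcases K.eq_empty_or_nonempty with rfl | hne
  · exact ⟨1, 1, one_pos, le_rfl, empty_subset _⟩
  · obtain ⟨a, ha⟩ := hK.exists_isLeast hne
    obtain ⟨b, hb⟩ := hK.exists_isGreatest hne
    exact ⟨a, b, h0 ha.1, ha.2 hb.1, fun x hx => ⟨ha.2 hx, hb.2 hx⟩⟩

theorem locallyIntegrableOn_Ioi_zero_iff {E : Type*} [NormedAddCommGroup E] {v : ℝ → E} :
    LocallyIntegrableOn v (Ioi 0) ↔ ∀ a b, 0 < a → a ≤ b → IntervalIntegrable v volume a b := by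
  rw [locallyIntegrableOn_iff isOpen_Ioi.isLocallyClosed]
  constructor
  · intro h a b ha hab
    rw [intervalIntegrable_iff_integrableOn_Icc_of_le hab]
    exact h _ (fun t ht => ha.trans_le ht.1) isCompact_Icc
  · intro h K hK hKc
    obtain ⟨a, b, ha, hab, hsub⟩ := exists_Icc_of_isCompact_subset_Ioi hKc hK
    exact ((intervalIntegrable_iff_integrableOn_Icc_of_le hab).mp (h a b ha hab)).mono_set hsub

/-- A smooth function vanishing outside `[a, b] ⊆ (0, ∞)`, as a test function. -/
def TestFun.ofIcc (φ : ℝ → ℝ) (hφ : ContDiff ℝ ∞ φ) {a b : ℝ} (ha : 0 < a)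
    (h : ∀ t, t ∉ Icc a b → φ t = 0) : TestFun where
  toFun := φ
  contDiff' := hφ
  hasCompactSupport' := HasCompactSupport.intro isCompact_Icc fun {t} => h t
  tsupport_subset' := (closure_minimal (fun t ht => not_not.mp (mt (h t) ht)) isClosed_Icc).trans
    fun _ ht => ha.trans_le ht.1

theorem TestFun.eq_zero_of_notMem (φ : TestFun) {t : ℝ} (ht : t ∉ Ioi (0 : ℝ)) : φ t = 0 :=
  image_eq_zero_of_notMem_tsupport (mt (fun h => φ.tsupport_subset h) ht)

theorem TestFun.deriv_eq_zero_of_notMem (φ : TestFun) {t : ℝ} (ht : t ∉ Ioi (0 : ℝ)) :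
    deriv φ t = 0 :=
  by_contra fun h => ht (φ.tsupport_subset (support_deriv_subset h))

theorem TestFun.integrable (φ : TestFun) : Integrable φ :=
  φ.continuous.integrable_of_hasCompactSupport φ.hasCompactSupport

theorem TestFun.continuous_deriv (φ : TestFun) : Continuous (deriv φ) :=
  φ.contDiff.continuous_deriv (by simp)

theorem TestFun.isPrimitive_deriv (φ : TestFun) : IsPrimitive φ (deriv φ) :=
  isPrimitive_of_hasDerivAt (fun t => (φ.contDiff.differentiable (by simp) t).hasDerivAt)
    φ.continuous_deriv

theorem exists_testFun_integral_eq_one : ∃ ρ : TestFun, ∫ t, ρ t = 1 := by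
  let f : ContDiffBump (2 : ℝ) := ⟨1 / 2, 1, by norm_num, by norm_num⟩
  refine ⟨TestFun.ofIcc (f.normed volume) f.contDiff_normed (a := 1) (b := 3) one_pos
    fun t ht => ?_, f.integral_normed⟩
  refine Function.notMem_support.mp fun h => ht ?_
  rw [f.support_normed_eq, Real.ball_eq_Ioo] at h
  exact ⟨by linarith [h.1], by linarith [h.2]⟩

theorem exists_testFun_deriv_eq {ψ : TestFun} (h0 : ∫ t, ψ t = 0) :
    ∃ Ψ : TestFun, deriv Ψ = ψ := by
  obtain ⟨a, b, ha, -, hsub⟩ :=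
    exists_Icc_of_isCompact_subset_Ioi ψ.hasCompactSupport ψ.tsupport_subset
  have hz {t : ℝ} (ht : t ∉ Icc a b) : ψ t = 0 := image_eq_zero_of_notMem_tsupport (mt (@hsub t) ht)
  have hd (t : ℝ) : HasDerivAt (fun t => ∫ s in Iic t, ψ s) (ψ t) t := by
    have heq : (fun t => ∫ s in Iic t, ψ s) =
        fun t => (∫ s in (0 : ℝ)..t, ψ s) + ∫ s in Iic 0, ψ s := by
      ext t
      rw [← intervalIntegral.integral_Iic_sub_Iic ψ.integrable.integrableOn
        ψ.integrable.integrableOn, sub_add_cancel]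
    rw [heq]
    exact (ψ.continuous.integral_hasStrictDerivAt 0 t).hasDerivAt.add_const _
  have hderiv : deriv (fun t => ∫ s in Iic t, ψ s) = ψ := funext fun t => (hd t).deriv
  refine ⟨TestFun.ofIcc _ ?_ (a := a) (b := b) ha fun t ht => ?_, hderiv⟩
  · rw [contDiff_infty_iff_deriv, hderiv]
    exact ⟨fun t => (hd t).differentiableAt, ψ.contDiff⟩
  · rcases lt_or_ge t a with hta | hta
    · exact setIntegral_eq_zero_of_forall_eq_zero fun s hs =>
        hz fun h => absurd (h.1.trans hs) hta.not_ge
    · have hbt : b < t := not_le.mp fun h => ht ⟨hta, h⟩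
      rw [setIntegral_eq_integral_of_forall_compl_eq_zero, h0]
      exact fun s hs => hz fun h => hs (h.2.trans hbt.le)

theorem exists_eq_integral_smul_of_forall_deriv {V : Type*} [AddCommGroup V] [Module ℝ V]
    (Λ : TestFun →ₗ[ℝ] V) (hΛ : ∀ ψ Ψ : TestFun, deriv Ψ = ψ → Λ ψ = 0) :
    ∃ c, ∀ φ : TestFun, Λ φ = (∫ t, φ t) • c := by
  obtain ⟨ρ, hρ⟩ := exists_testFun_integral_eq_one
  refine ⟨Λ ρ, fun φ => ?_⟩
  have hzero : ∫ t, (φ - (∫ t, φ t) • ρ) t = 0 := by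
    change ∫ t, (φ t - (∫ t, φ t) • ρ t) = 0
    have hρi : Integrable fun s => (∫ t, φ t) • ρ s := ρ.integrable.smul (∫ t, φ t)
    rw [integral_sub φ.integrable hρi, integral_smul, hρ, smul_eq_mul, mul_one, sub_self]
  obtain ⟨Ψ, hΨ⟩ := exists_testFun_deriv_eq hzero
  rw [← sub_eq_zero, ← map_smul, ← map_sub]
  exact hΛ _ Ψ hΨ

end TestFunctions

section WeakDerivatives

variable {H : Type*} [NormedAddCommGroup H] [InnerProductSpace ℂ H]

theorem TestFun.integral_deriv_smul [CompleteSpace H] (φ : TestFun) {V v : ℝ → H}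
    (hV : IsPrimitive V v) : ∫ t, deriv φ t • V t = -∫ t, φ t • v t := by
  have hVi : LocallyIntegrableOn V (Ioi 0) :=
    hV.continuous.locallyIntegrable.locallyIntegrableOn _
  have hvi : LocallyIntegrableOn v (Ioi 0) :=
    locallyIntegrableOn_Ioi_zero_iff.mpr fun a b _ _ => hV.intervalIntegrable a b
  have hprim := φ.isPrimitive_deriv.smul hV
  have hi := integrable_test_smul hVi φ.continuous φ.hasCompactSupport φ.tsupport_subset
  have hi' := integrable_test_smul hvi φ.continuous φ.hasCompactSupport φ.tsupport_subset
  have hi'' : Integrable fun t => deriv φ t • V t := by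
    simpa only [iteratedDeriv_one] using
      integrable_iteratedDeriv_smul hVi 1 φ.contDiff φ.hasCompactSupport φ.tsupport_subset
  have hIoi := hprim.integral_Ioi_eq_neg hi.integrableOn (hi''.add hi').integrableOn
  rw [setIntegral_eq_integral_of_forall_compl_eq_zero fun t ht => by
      rw [φ.eq_zero_of_notMem ht, φ.deriv_eq_zero_of_notMem ht, zero_smul, zero_smul, add_zero],
    integral_add hi'' hi', φ.eq_zero_of_notMem self_notMem_Ioi, zero_smul, neg_zero] at hIoi
  exact eq_neg_of_add_eq_zero_left hIoi

/-- The distributional derivative of order `k` of a locally integrable function, up to the factor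
`(-1) ^ k`: the functional `φ ↦ ∫ φ^{(k)} u`. -/
def iteratedDerivPairing (k : ℕ) {u : ℝ → H} (hu : LocallyIntegrableOn u (Ioi 0)) :
    TestFun →ₗ[ℝ] H where
  toFun φ := ∫ t, iteratedDeriv k φ t • u t
  map_add' φ ψ := by
    rw [← integral_add (integrable_iteratedDeriv_smul hu k φ.contDiff φ.hasCompactSupport
      φ.tsupport_subset) (integrable_iteratedDeriv_smul hu k ψ.contDiff ψ.hasCompactSupport
      ψ.tsupport_subset)]
    refine integral_congr_ae (ae_of_all _ fun t => ?_)
    change iteratedDeriv k (φ + ψ : ℝ → ℝ) t • u t = _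
    rw [iteratedDeriv_add (φ.contDiff.of_le (by exact_mod_cast le_top)).contDiffAt
      (ψ.contDiff.of_le (by exact_mod_cast le_top)).contDiffAt, add_smul]
  map_smul' c φ := by
    rw [RingHom.id_apply, ← integral_smul]
    refine integral_congr_ae (ae_of_all _ fun t => ?_)
    change iteratedDeriv k (c • (φ : ℝ → ℝ)) t • u t = _
    rw [iteratedDeriv_const_smul (φ.contDiff.of_le (by exact_mod_cast le_top)).contDiffAt,
      smul_assoc]

theorem HasWeakDeriv.exists_primitive [CompleteSpace H] {k : ℕ} {u v : ℝ → H}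
    (h : HasWeakDeriv (k + 1) u v) (hv : ∀ a b, IntervalIntegrable v volume a b) :
    ∃ V, IsPrimitive V v ∧ HasWeakDeriv k u V := by
  have hV := isPrimitive_integral_add hv 0
  set V : ℝ → H := fun t => (∫ s in (0 : ℝ)..t, v s) + 0
  have hVl : LocallyIntegrableOn V (Ioi 0) :=
    hV.continuous.locallyIntegrable.locallyIntegrableOn _
  obtain ⟨c, hc⟩ := exists_eq_integral_smul_of_forall_deriv
    (iteratedDerivPairing k h.left - (-1 : ℝ) ^ k • iteratedDerivPairing 0 hVl) fun ψ Ψ hΨ => by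
      have hu := h.eq Ψ Ψ.contDiff Ψ.hasCompactSupport Ψ.tsupport_subset
      have hparts := Ψ.integral_deriv_smul hV
      rw [iteratedDeriv_succ', hΨ] at hu
      rw [hΨ] at hparts
      change (∫ t, iteratedDeriv k ψ t • u t) - (-1 : ℝ) ^ k • ∫ t, iteratedDeriv 0 ψ t • V t = 0
      rw [iteratedDeriv_zero, hu, hparts, pow_succ, mul_neg_one, neg_smul, smul_neg, sub_self]
  have hVc := isPrimitive_integral_add hv ((-1 : ℝ) ^ k • c)
  refine ⟨_, hVc, h.left, hVc.continuous.locallyIntegrable.locallyIntegrableOn _,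
    fun φ hφ hφc hφs => ?_⟩
  have hφc' : (∫ t, iteratedDeriv k φ t • u t) - (-1 : ℝ) ^ k • ∫ t, iteratedDeriv 0 φ t • V t =
      (∫ t, φ t) • c := hc ⟨φ, hφ, hφc, hφs⟩
  have hsplit : ∫ t, φ t • ((∫ s in (0 : ℝ)..t, v s) + (-1 : ℝ) ^ k • c) =
      (∫ t, φ t • V t) + (∫ t, φ t) • (-1 : ℝ) ^ k • c := by
    simp only [V, add_zero, ← integral_smul_const, smul_add] at hVl ⊢
    exact integral_add (integrable_test_smul hVl hφ.continuous hφc hφs)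
      ((hφ.continuous.integrable_of_hasCompactSupport hφc).smul_const _)
  rw [hsplit, smul_add, smul_comm ((-1 : ℝ) ^ k) (∫ t, φ t), smul_smul ((-1 : ℝ) ^ k), ← mul_pow,
    neg_one_mul, neg_neg, one_pow, one_smul, ← hφc', iteratedDeriv_zero, add_sub_cancel]

theorem HasWeakDeriv.exists_derivatives [CompleteSpace H] {n : ℕ} {u v : ℝ → H}
    (h : HasWeakDeriv n u v) (hv : ∀ a b, IntervalIntegrable v volume a b) :
    ∃ d : ℕ → ℝ → H, d n = v ∧ (∀ k < n, IsPrimitive (d k) (d (k + 1))) ∧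
      ∀ k ≤ n, HasWeakDeriv k u (d k) := by
  induction n generalizing v with
  | zero => exact ⟨fun _ => v, rfl, by simp, fun k hk => by rwa [Nat.le_zero.mp hk]⟩
  | succ n ih =>
    obtain ⟨V, hV, hVu⟩ := h.exists_primitive hv
    obtain ⟨d, hd, hp, hw⟩ := ih hVu fun a b => hV.continuous.intervalIntegrable a b
    refine ⟨Function.update d (n + 1) v, by simp, fun k hk => ?_, fun k hk => ?_⟩
    · rw [Function.update_of_ne (by omega)]
      rcases Nat.lt_succ_iff_lt_or_eq.mp hk with hk' | rfl
      · rw [Function.update_of_ne (by omega)]; exact hp k hk'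
      · rw [Function.update_self, hd]; exact hV
    · rcases Nat.le_succ_iff.mp hk with hk' | rfl
      · rw [Function.update_of_ne (by omega)]; exact hw k hk'
      · rwa [Function.update_self]

theorem hasWeakDeriv_zero_self {u : ℝ → H} (hu : LocallyIntegrableOn u (Ioi 0)) :
    HasWeakDeriv 0 u u :=
  ⟨hu, hu, by simp⟩

end WeakDerivatives

section LocalEstimate

open scoped ENNReal NNReal

variable {H : Type*} [NormedAddCommGroup H] [InnerProductSpace ℂ H]

theorem HasWeakDeriv.comp_add_right {k : ℕ} {u v : ℝ → H} (h : HasWeakDeriv k u v) {τ : ℝ}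
    (hτ : 0 ≤ τ) : HasWeakDeriv k (fun t => u (t + τ)) (fun t => v (t + τ)) := by
  have hloc {w : ℝ → H} (hw : LocallyIntegrableOn w (Ioi 0)) :
      LocallyIntegrableOn (fun t => w (t + τ)) (Ioi 0) := by
    rw [locallyIntegrableOn_Ioi_zero_iff] at hw ⊢
    intro a b ha hab
    simpa using (hw (a + τ) (b + τ) (by positivity) (by linarith)).comp_add_right τ
  refine ⟨hloc h.left, hloc h.right, fun φ hφ hφc hφs => ?_⟩
  have hsub : tsupport (fun t => φ (t - τ)) ⊆ Ioi 0 := by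
    refine (tsupport_comp_subset_preimage φ (continuous_sub_right τ)).trans fun t ht => ?_
    have htτ : 0 < t - τ := hφs ht
    exact hτ.trans_lt (sub_pos.mp htτ)
  have heq := h.eq (fun t => φ (t - τ)) (hφ.comp (contDiff_id.sub contDiff_const))
    (hφc.comp_homeomorph (Homeomorph.subRight τ)) hsub
  rw [iteratedDeriv_comp_sub_const, ← integral_add_right_eq_self _ τ,
    ← integral_add_right_eq_self (fun t => φ (t - τ) • v t) τ] at heq
  simpa only [add_sub_cancel_right] using heq

theorem exists_cutoff : ∃ χ : ℝ → ℝ, ContDiff ℝ ∞ χ ∧ χ 0 = 1 ∧ χ 1 = 0 ∧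
    tsupport (deriv χ) ⊆ Ioo 0 1 := by
  refine ⟨fun s => Real.smoothTransition (2 - 3 * s), ?_, ?_, ?_, ?_⟩
  · exact Real.smoothTransition.contDiff.comp (contDiff_const.sub (contDiff_const.mul contDiff_id))
  · exact Real.smoothTransition.one_of_one_le (by norm_num)
  · exact Real.smoothTransition.zero_of_nonpos (by norm_num)
  · have hsupp : tsupport (deriv fun s => Real.smoothTransition (2 - 3 * s)) ⊆
        Icc (1 / 3) (2 / 3) := by
      refine closure_minimal (fun s hs => ?_) isClosed_Icc
      contrapose! hs
      rw [mem_Icc, not_and_or, not_le, not_le] at hs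
      rw [Function.notMem_support]
      rcases hs with hs | hs
      · have hone : (fun s : ℝ => Real.smoothTransition (2 - 3 * s)) =ᶠ[nhds s] fun _ => 1 := by
          filter_upwards [eventually_lt_nhds hs] with x hx
          exact Real.smoothTransition.one_of_one_le (by linarith)
        rw [hone.deriv_eq, deriv_const]
      · have hzero : (fun s : ℝ => Real.smoothTransition (2 - 3 * s)) =ᶠ[nhds s] fun _ => 0 := by
          filter_upwards [eventually_gt_nhds hs] with x hx
          exact Real.smoothTransition.zero_of_nonpos (by linarith)
        rw [hzero.deriv_eq, deriv_const]
    exact hsupp.trans (Icc_subset_Ioo (by norm_num) (by norm_num))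

theorem support_iteratedDeriv_subset_tsupport (k : ℕ) (φ : ℝ → ℝ) :
    Function.support (iteratedDeriv k φ) ⊆ tsupport φ := fun t ht =>
  support_iteratedFDeriv_subset (𝕜 := ℝ) k fun h => ht (by simp [iteratedDeriv, h])

theorem IsPrimitive.apply_zero_eq_of_cutoff [CompleteSpace H] {χ : ℝ → ℝ} (hχ : ContDiff ℝ ∞ χ)
    (h0 : χ 0 = 1) (h1 : χ 1 = 0) (hs : tsupport (deriv χ) ⊆ Ioo 0 1) {k : ℕ} {u d d' : ℝ → H}
    (hd : IsPrimitive d d') (hu : HasWeakDeriv k u d) :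
    d 0 = -((-1 : ℝ) ^ k • (∫ s in Ioc 0 1, iteratedDeriv (k + 1) χ s • u s) +
      ∫ s in Ioc 0 1, χ s • d' s) := by
  have hχd : ContDiff ℝ ∞ (deriv χ) := (contDiff_infty_iff_deriv.mp hχ).2
  have hχ' : IsPrimitive χ (deriv χ) :=
    isPrimitive_of_hasDerivAt (fun t => (hχ.differentiable (by simp) t).hasDerivAt) hχd.continuous
  have hparts : (∫ s in Ioc 0 1, deriv χ s • d s) + ∫ s in Ioc 0 1, χ s • d' s = -d 0 := by
    have hint := (hχ'.smul hd).integral_eq 0 1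
    have hint₁ : IntervalIntegrable (fun s => deriv χ s • d s) volume 0 1 :=
      (hχd.continuous.smul hd.continuous).intervalIntegrable _ _
    rwa [h0, h1, zero_smul, one_smul, zero_sub, intervalIntegral.integral_add hint₁
      ((hd.intervalIntegrable _ _).continuousOn_smul hχ.continuous.continuousOn),
      intervalIntegral.integral_of_le zero_le_one,
      intervalIntegral.integral_of_le zero_le_one] at hint
  have htest := hu.eq (deriv χ) hχd (HasCompactSupport.of_support_subset_isCompact isCompact_Icc
    ((subset_tsupport _).trans (hs.trans Ioo_subset_Icc_self))) fun s h => (hs h).1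
  have hd_zero (s : ℝ) (h : s ∉ Ioc (0 : ℝ) 1) : deriv χ s • d s = 0 := by
    rw [image_eq_zero_of_notMem_tsupport fun h' => h (Ioo_subset_Ioc_self (hs h')), zero_smul]
  have hu_zero (s : ℝ) (h : s ∉ Ioc (0 : ℝ) 1) : iteratedDeriv k (deriv χ) s • u s = 0 := by
    rw [Function.notMem_support.mp fun h' => h (Ioo_subset_Ioc_self (hs
      (support_iteratedDeriv_subset_tsupport k _ h'))), zero_smul]
  rw [iteratedDeriv_succ', setIntegral_eq_integral_of_forall_compl_eq_zero hu_zero, htest,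
    ← setIntegral_eq_integral_of_forall_compl_eq_zero hd_zero, smul_smul, ← mul_pow,
    neg_one_mul, neg_neg, one_pow, one_smul, hparts, neg_neg]

theorem exists_enorm_setIntegral_smul_le {φ : ℝ → ℝ} (hφ : Continuous φ) {K : Set ℝ}
    (hK : IsCompact K) : ∃ M : ℝ≥0, ∀ {S : Set ℝ} {g : ℝ → H}, S ⊆ K → MeasurableSet S →
      ‖∫ s in S, φ s • g s‖ₑ ≤ M * ∫⁻ s in S, ‖g s‖ₑ := by
  obtain ⟨M, hM⟩ := hK.exists_bound_of_continuousOn hφ.continuousOn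
  refine ⟨M.toNNReal, fun hS hSm => (enorm_integral_le_lintegral_enorm _).trans ?_⟩
  rw [← lintegral_const_mul' _ _ ENNReal.coe_ne_top]
  refine setLIntegral_mono' hSm fun s hs => ?_
  rw [enorm_smul, ← ofReal_norm]
  gcongr
  exact ENNReal.ofReal_le_ofReal (hM s (hS hs))

theorem exists_enorm_le_lintegral_Ioc [CompleteSpace H] (k : ℕ) :
    ∃ M : ℝ≥0, ∀ u d d' : ℝ → H, HasWeakDeriv k u d → IsPrimitive d d' →
      ∀ t, 0 ≤ t → ‖d t‖ₑ ≤ M * ∫⁻ s in Ioc 0 1, ‖‖u (s + t)‖ + ‖d' (s + t)‖‖ₑ := by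
  obtain ⟨χ, hχ, h0, h1, hs⟩ := exists_cutoff
  obtain ⟨M, hM⟩ := exists_enorm_setIntegral_smul_le (H := H)
    (hχ.continuous_iteratedDeriv (k + 1) (by exact_mod_cast le_top))
    (isCompact_Icc (a := 0) (b := 1))
  obtain ⟨N, hN⟩ := exists_enorm_setIntegral_smul_le (H := H) hχ.continuous
    (isCompact_Icc (a := 0) (b := 1))
  refine ⟨max M N, fun u d d' hu hd t ht => ?_⟩
  have hdt := hd.comp_add_right t
  have hrep := hdt.apply_zero_eq_of_cutoff hχ h0 h1 hs (hu.comp_add_right ht)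
  rw [zero_add] at hrep
  have hmeas : AEMeasurable (fun s => ‖d' (s + t)‖ₑ) (volume.restrict (Ioc 0 1)) :=
    (hdt.intervalIntegrable 0 1).1.aestronglyMeasurable.enorm
  calc ‖d t‖ₑ ≤ ‖∫ s in Ioc 0 1, iteratedDeriv (k + 1) χ s • u (s + t)‖ₑ +
        ‖∫ s in Ioc 0 1, χ s • d' (s + t)‖ₑ := by
        rw [hrep, enorm_neg]
        refine (enorm_add_le _ _).trans_eq ?_
        rw [enorm_smul, enorm_pow, enorm_neg, enorm_one, one_pow, one_mul]
    _ ≤ M * (∫⁻ s in Ioc 0 1, ‖u (s + t)‖ₑ) + N * ∫⁻ s in Ioc 0 1, ‖d' (s + t)‖ₑ :=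
        add_le_add (hM Ioc_subset_Icc_self measurableSet_Ioc)
          (hN Ioc_subset_Icc_self measurableSet_Ioc)
    _ ≤ ↑(max M N) * ((∫⁻ s in Ioc 0 1, ‖u (s + t)‖ₑ) + ∫⁻ s in Ioc 0 1, ‖d' (s + t)‖ₑ) := by
        rw [mul_add]
        gcongr
        exacts [le_max_left _ _, le_max_right _ _]
    _ = ↑(max M N) * ∫⁻ s in Ioc 0 1, ‖‖u (s + t)‖ + ‖d' (s + t)‖‖ₑ := by
        rw [← lintegral_add_right' _ hmeas]
        simp only [Real.enorm_of_nonneg (add_nonneg (norm_nonneg _) (norm_nonneg _)),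
          ENNReal.ofReal_add (norm_nonneg _) (norm_nonneg _), ofReal_norm]

end LocalEstimate

section WeightedLebesgue

open scoped ENNReal NNReal

variable {E : Type*} [NormedAddCommGroup E]

theorem lintegral_weightedMeasure (κ : ℝ) (f : ℝ → ℝ≥0∞) :
    ∫⁻ t, f t ∂(weightedMeasure κ) =
      ∫⁻ t in Ioi 0, ENNReal.ofReal (Real.exp (-κ * t)) * f t := by
  rw [weightedMeasure, lintegral_withDensity_eq_lintegral_mul_non_measurable _ (by fun_prop)
    (ae_of_all _ fun _ => ENNReal.ofReal_lt_top), restrict_Ioi_eq_restrict_Ici]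
  rfl

theorem ofReal_exp_neg_mul_le (κ : ℝ) {s t R : ℝ} (h : |s - t| ≤ R) :
    ENNReal.ofReal (Real.exp (-κ * t)) ≤
      ENNReal.ofReal (Real.exp (|κ| * R)) * ENNReal.ofReal (Real.exp (-κ * s)) := by
  rw [← ENNReal.ofReal_mul (Real.exp_pos _).le, ← Real.exp_add]
  refine ENNReal.ofReal_le_ofReal (Real.exp_le_exp.mpr ?_)
  have hκ : κ * (s - t) ≤ |κ| * R := (le_abs_self _).trans (by rw [abs_mul]; gcongr)
  linarith

theorem restrict_Ioc_le_weightedMeasure (κ R : ℝ) :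
    volume.restrict (Ioc 0 R) ≤ ENNReal.ofReal (Real.exp (|κ| * R)) • weightedMeasure κ := by
  refine Measure.le_iff.mpr fun s hs => ?_
  rw [Measure.smul_apply, weightedMeasure, withDensity_apply _ hs, Measure.restrict_restrict hs,
    Measure.restrict_apply hs, smul_eq_mul, ← lintegral_const_mul _ (by fun_prop)]
  calc volume (s ∩ Ioc 0 R) = ∫⁻ _ in s ∩ Ioc 0 R, ENNReal.ofReal (Real.exp (-κ * 0)) := by simp
    _ ≤ ∫⁻ t in s ∩ Ioc 0 R, ENNReal.ofReal (Real.exp (|κ| * R)) *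
        ENNReal.ofReal (Real.exp (-κ * t)) :=
      setLIntegral_mono' (hs.inter measurableSet_Ioc) fun t ht => ofReal_exp_neg_mul_le κ
        (by rw [sub_zero, abs_of_pos ht.2.1]; exact ht.2.2)
    _ ≤ _ := lintegral_mono_set (inter_subset_inter_right _ fun t ht => ht.1.le)

theorem intervalIntegrable_indicator_of_memLp {κ : ℝ} {p : ℝ≥0∞} (hp : 1 ≤ p) {f : ℝ → E}
    (hf : MemLp f p (weightedMeasure κ)) (a b : ℝ) :
    IntervalIntegrable ((Ioi 0).indicator f) volume a b := by
  have hIoc (R : ℝ) : IntegrableOn f (Ioc 0 R) :=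
    (hf.of_measure_le_smul ENNReal.ofReal_ne_top
      (restrict_Ioc_le_weightedMeasure κ R)).integrable hp
  rw [intervalIntegrable_iff, IntegrableOn, integrable_indicator_iff measurableSet_Ioi,
    IntegrableOn, Measure.restrict_restrict measurableSet_Ioi]
  exact (hIoc (max a b)).mono_set fun t ht => ⟨ht.1, ht.2.2⟩

theorem lintegral_comp_add_left_weightedMeasure_le (κ : ℝ) (f : ℝ → ℝ≥0∞) {s : ℝ} (hs : 0 ≤ s) :
    ∫⁻ t, f (s + t) ∂(weightedMeasure κ) ≤
      ENNReal.ofReal (Real.exp (|κ| * s)) * ∫⁻ t, f t ∂(weightedMeasure κ) := by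
  rw [lintegral_weightedMeasure, lintegral_weightedMeasure,
    ← lintegral_const_mul' _ _ ENNReal.ofReal_ne_top]
  let F : ℝ → ℝ≥0∞ := fun t =>
    ENNReal.ofReal (Real.exp (|κ| * s)) * (ENNReal.ofReal (Real.exp (-κ * t)) * f t)
  calc ∫⁻ t in Ioi 0, ENNReal.ofReal (Real.exp (-κ * t)) * f (s + t)
      ≤ ∫⁻ t in Ioi 0, F (s + t) := by
        refine lintegral_mono fun t => ?_
        simp only [F, ← mul_assoc]
        gcongr
        exact ofReal_exp_neg_mul_le κ (by rw [add_sub_cancel_right, abs_of_nonneg hs])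
    _ = ∫⁻ t in Ioi s, F t := by
        have hshift := (measurePreserving_add_left volume s).setLIntegral_comp_preimage_emb
          (measurableEmbedding_addLeft s) F (Ioi s)
        rwa [preimage_const_add_Ioi, sub_self] at hshift
    _ ≤ ∫⁻ t in Ioi 0, F t := lintegral_mono_set (Ioi_subset_Ioi hs)

theorem lintegral_lintegral_Ioc_weightedMeasure_le (κ : ℝ) {f : ℝ → ℝ≥0∞} (hf : Measurable f) :
    ∫⁻ t, (∫⁻ s in Ioc 0 1, f (s + t)) ∂(weightedMeasure κ) ≤
      ENNReal.ofReal (Real.exp |κ|) * ∫⁻ t, f t ∂(weightedMeasure κ) := by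
  have : SFinite (weightedMeasure κ) := by unfold weightedMeasure; infer_instance
  rw [lintegral_lintegral_swap (by fun_prop)]
  calc ∫⁻ s in Ioc 0 1, ∫⁻ t, f (s + t) ∂(weightedMeasure κ)
      ≤ ∫⁻ _ in Ioc (0 : ℝ) 1, ENNReal.ofReal (Real.exp |κ|) *
          ∫⁻ t, f t ∂(weightedMeasure κ) := by
        refine setLIntegral_mono' measurableSet_Ioc fun s hs => ?_
        refine (lintegral_comp_add_left_weightedMeasure_le κ f hs.1.le).trans ?_
        gcongr
        exact mul_le_of_le_one_right (abs_nonneg κ) hs.2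
    _ = _ := by simp

theorem memLp_two_iff_lintegral {α : Type*} [MeasurableSpace α] {μ : Measure α} {f : α → E} :
    MemLp f 2 μ ↔ AEStronglyMeasurable f μ ∧ ∫⁻ t, ‖f t‖ₑ ^ 2 ∂μ < ⊤ := by
  rw [MemLp, eLpNorm_lt_top_iff_lintegral_rpow_enorm_lt_top two_ne_zero ENNReal.ofNat_ne_top]
  simp

theorem sq_lintegral_le_lintegral_sq {α : Type*} [MeasurableSpace α] {μ : Measure α}
    [IsProbabilityMeasure μ] {f : α → ℝ≥0∞} (hf : AEMeasurable f μ) :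
    (∫⁻ t, f t ∂μ) ^ 2 ≤ ∫⁻ t, f t ^ 2 ∂μ := by
  have hle := eLpNorm_le_eLpNorm_of_exponent_le (p := (1 : ℝ≥0)) (q := (2 : ℝ≥0))
    (by norm_num) hf.aestronglyMeasurable
  have hsq := eLpNorm_nnreal_pow_eq_lintegral (f := f) (μ := μ) (p := 2) two_ne_zero
  simp only [NNReal.coe_ofNat, ENNReal.rpow_ofNat, enorm_eq_self] at hsq
  rw [← hsq]
  gcongr
  simpa [eLpNorm_one_eq_lintegral_enorm] using hle

theorem memLp_of_enorm_le_lintegral_Ioc {κ : ℝ} {g : ℝ → E} {h : ℝ → ℝ}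
    (hg : AEStronglyMeasurable g (weightedMeasure κ)) (hhm : Measurable h)
    (hh : MemLp h 2 (weightedMeasure κ)) {M : ℝ≥0}
    (hgh : ∀ t, 0 ≤ t → ‖g t‖ₑ ≤ M * ∫⁻ s in Ioc 0 1, ‖h (s + t)‖ₑ) :
    MemLp g 2 (weightedMeasure κ) := by
  rw [memLp_two_iff_lintegral] at hh ⊢
  refine ⟨hg, ?_⟩
  have : IsProbabilityMeasure (volume.restrict (Ioc (0 : ℝ) 1)) := ⟨by simp⟩
  calc ∫⁻ t, ‖g t‖ₑ ^ 2 ∂(weightedMeasure κ)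
      ≤ ∫⁻ t, M ^ 2 * (∫⁻ s in Ioc 0 1, ‖h (s + t)‖ₑ ^ 2) ∂(weightedMeasure κ) := by
        refine lintegral_mono_ae ?_
        rw [ae_weightedMeasure]
        filter_upwards [ae_restrict_mem measurableSet_Ioi] with t ht
        calc ‖g t‖ₑ ^ 2 ≤ (M * ∫⁻ s in Ioc 0 1, ‖h (s + t)‖ₑ) ^ 2 := by
              gcongr; exact hgh t (le_of_lt ht)
          _ ≤ _ := by
              rw [mul_pow]
              gcongr
              exact sq_lintegral_le_lintegral_sq (by fun_prop)
    _ = M ^ 2 * ∫⁻ t, (∫⁻ s in Ioc 0 1, ‖h (s + t)‖ₑ ^ 2) ∂(weightedMeasure κ) :=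
        lintegral_const_mul' _ _ (ENNReal.pow_ne_top ENNReal.coe_ne_top)
    _ ≤ M ^ 2 * (ENNReal.ofReal (Real.exp |κ|) * ∫⁻ s, ‖h s‖ₑ ^ 2 ∂(weightedMeasure κ)) := by
        gcongr
        exact lintegral_lintegral_Ioc_weightedMeasure_le κ (f := fun s => ‖h s‖ₑ ^ 2)
          (by fun_prop)
    _ < ⊤ := ENNReal.mul_lt_top (ENNReal.pow_lt_top ENNReal.coe_lt_top)
        (ENNReal.mul_lt_top ENNReal.ofReal_lt_top hh.2)

theorem memLp_derivatives {H : Type*} [NormedAddCommGroup H] [InnerProductSpace ℂ H]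
    [CompleteSpace H] {κ : ℝ} {n : ℕ} {u : ℝ → H} {d : ℕ → ℝ → H}
    (hum : StronglyMeasurable u) (hu : MemLp u 2 (weightedMeasure κ))
    (hdm : StronglyMeasurable (d n)) (hdn : MemLp (d n) 2 (weightedMeasure κ))
    (hp : ∀ k < n, IsPrimitive (d k) (d (k + 1))) (hw : ∀ k ≤ n, HasWeakDeriv k u (d k))
    {k : ℕ} (hk : k ≤ n) : MemLp (d k) 2 (weightedMeasure κ) := by
  have hm (k : ℕ) (hk : k ≤ n) : Measurable fun t => ‖d k t‖ := by
    rcases hk.lt_or_eq with h | rfl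
    · exact (hp k h).continuous.norm.measurable
    · exact hdm.norm.measurable
  induction hk using Nat.decreasingInduction with
  | self => exact hdn
  | of_succ k hk ih =>
    obtain ⟨M, hM⟩ := exists_enorm_le_lintegral_Ioc (H := H) k
    exact memLp_of_enorm_le_lintegral_Ioc (hp k hk).continuous.aestronglyMeasurable
      (hum.norm.measurable.add (hm (k + 1) hk)) (hu.norm.add ih.norm)
      (hM u (d k) (d (k + 1)) (hw k hk.le) (hp k hk))

end WeightedLebesgue

section EnergyIdentity

variable {H : Type*} [NormedAddCommGroup H] [InnerProductSpace ℂ H]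

theorem integrable_weightedMeasure_iff {E : Type*} [NormedAddCommGroup E] [NormedSpace ℝ E]
    (κ : ℝ) {h : ℝ → E} :
    Integrable h (weightedMeasure κ) ↔ IntegrableOn (fun t => Real.exp (-κ * t) • h t) (Ioi 0) := by
  rw [weightedMeasure, integrable_withDensity_iff_integrable_smul' (by fun_prop)
    (ae_of_all _ fun t => ENNReal.ofReal_lt_top), IntegrableOn, restrict_Ioi_eq_restrict_Ici]
  simp_rw [ENNReal.toReal_ofReal (Real.exp_pos _).le]

theorem integral_weightedMeasure {E : Type*} [NormedAddCommGroup E] [NormedSpace ℝ E]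
    (κ : ℝ) (h : ℝ → E) :
    ∫ t, h t ∂(weightedMeasure κ) = ∫ t in Ioi 0, Real.exp (-κ * t) • h t := by
  rw [weightedMeasure, integral_withDensity_eq_integral_toReal_smul (by fun_prop)
    (ae_of_all _ fun t => ENNReal.ofReal_lt_top), restrict_Ioi_eq_restrict_Ici]
  simp_rw [ENNReal.toReal_ofReal (Real.exp_pos _).le]

theorem IsPrimitive.exp_smul [CompleteSpace H] {h h' : ℝ → H} (hh : IsPrimitive h h') (κ : ℝ) :
    IsPrimitive (fun t => Real.exp (-κ * t) • h t)
      (fun t => Real.exp (-κ * t) • (h' t - κ • h t)) := by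
  have hexp : IsPrimitive (fun t => Real.exp (-κ * t)) (fun t => Real.exp (-κ * t) * -κ) :=
    isPrimitive_of_hasDerivAt (fun t => by simpa using ((hasDerivAt_id t).const_mul (-κ)).exp)
      (by fun_prop)
  convert hexp.smul hh using 2 with t
  module

theorem integral_weightedMeasure_eq_of_isPrimitive [CompleteSpace H] {κ : ℝ} {h h' : ℝ → H}
    (hh : IsPrimitive h h') (h0 : h 0 = 0) (hi : Integrable h (weightedMeasure κ))
    (hi' : Integrable h' (weightedMeasure κ)) :
    ∫ t, h' t ∂(weightedMeasure κ) = κ • ∫ t, h t ∂(weightedMeasure κ) := by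
  have hκ : Integrable (fun t => κ • h t) (weightedMeasure κ) := hi.smul κ
  have hsub : Integrable (fun t => h' t - κ • h t) (weightedMeasure κ) := hi'.sub hκ
  have hIoi := (hh.exp_smul κ).integral_Ioi_eq_neg ((integrable_weightedMeasure_iff κ).mp hi)
    ((integrable_weightedMeasure_iff κ).mp hsub)
  rw [← integral_weightedMeasure, h0, smul_zero, neg_zero] at hIoi
  rw [← sub_eq_zero, ← integral_smul, ← integral_sub hi' hκ, hIoi]

theorem inner_toLp {α : Type*} [MeasurableSpace α] {μ : Measure α} {f g : α → H}
    (hf : MemLp f 2 μ) (hg : MemLp g 2 μ) :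
    inner ℂ (hf.toLp f) (hg.toLp g) = ∫ t, inner ℂ (f t) (g t) ∂μ := by
  rw [L2.inner_def]
  refine integral_congr_ae ?_
  filter_upwards [hf.coeFn_toLp, hg.coeFn_toLp] with t hft hgt
  rw [hft, hgt]

theorem integrable_inner_of_memLp {α : Type*} [MeasurableSpace α] {μ : Measure α} {f g : α → H}
    (hf : MemLp f 2 μ) (hg : MemLp g 2 μ) : Integrable (fun t => inner ℂ (f t) (g t)) μ := by
  refine (L2.integrable_inner (𝕜 := ℂ) (hf.toLp f) (hg.toLp g)).congr ?_
  filter_upwards [hf.coeFn_toLp, hg.coeFn_toLp] with t hft hgt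
  rw [hft, hgt]

theorem inner_toLp_add_inner_toLp_eq_of_isPrimitive [CompleteSpace H] {κ : ℝ}
    {f f' g g' : ℝ → H} (hf : IsPrimitive f f') (hf0 : f 0 = 0) (hg : IsPrimitive g g')
    (mf : MemLp f 2 (weightedMeasure κ)) (mf' : MemLp f' 2 (weightedMeasure κ))
    (mg : MemLp g 2 (weightedMeasure κ)) (mg' : MemLp g' 2 (weightedMeasure κ)) :
    inner ℂ (mf'.toLp f') (mg.toLp g) + inner ℂ (mf.toLp f) (mg'.toLp g') =
      κ * inner ℂ (mf.toLp f) (mg.toLp g) := by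
  have hint : IsPrimitive (fun t => inner ℂ (f t) (g t))
      (fun t => inner ℂ (f' t) (g t) + inner ℂ (f t) (g' t)) :=
    IsPrimitive.bilin (isBoundedBilinearMap_inner (𝕜 := ℂ) (E := H)).toContinuousLinearMap hf hg
  have h₁ := integrable_inner_of_memLp mf' mg
  have h₂ := integrable_inner_of_memLp mf mg'
  rw [inner_toLp, inner_toLp, inner_toLp, ← integral_add h₁ h₂,
    integral_weightedMeasure_eq_of_isPrimitive hint (by rw [hf0, inner_zero_left])
      (integrable_inner_of_memLp mf mg) (h₁.add h₂), Complex.real_smul]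

end EnergyIdentity

section Lift

variable {H : Type*} [NormedAddCommGroup H] [InnerProductSpace ℂ H] [CompleteSpace H]
  {α : Type*} [MeasurableSpace α] {μ : Measure α}

variable (μ) in
/-- Operators on `H` act pointwise on `L²(μ; H)`. Bundling this action as a star algebra
homomorphism transports powers, positivity and resolvents. -/
def liftL2 : (H →L[ℂ] H) →⋆ₐ[ℂ] (Lp H 2 μ →L[ℂ] Lp H 2 μ) where
  toFun S := S.compLpL 2 μ
  map_one' := by
    ext1 f
    exact Lp.ext (ContinuousLinearMap.coeFn_compLpL _ f)
  map_mul' S S' := by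
    ext1 f
    apply Lp.ext
    filter_upwards [(S * S').coeFn_compLpL f, S'.coeFn_compLpL f,
      S.coeFn_compLpL (S'.compLpL 2 μ f)] with t h h' h''
    rw [h, mul_apply_eq_comp, mul_apply_eq_comp, h'', h']
  map_zero' := by
    ext1 f
    apply Lp.ext
    filter_upwards [(0 : H →L[ℂ] H).coeFn_compLpL f, Lp.coeFn_zero H 2 μ] with t h h'
    rw [h, zero_apply, zero_apply, h', Pi.zero_apply]
  map_add' S S' := S.add_compLpL S'
  commutes' c := by
    ext1 f
    apply Lp.ext
    filter_upwards [(algebraMap ℂ (H →L[ℂ] H) c).coeFn_compLpL f, Lp.coeFn_smul c f] with t h h'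
    rw [h, ContinuousLinearMap.algebraMap_apply, ContinuousLinearMap.algebraMap_apply, h',
      Pi.smul_apply]
  map_star' S := by
    rw [ContinuousLinearMap.star_eq_adjoint, ContinuousLinearMap.star_eq_adjoint,
      ContinuousLinearMap.eq_adjoint_iff]
    intro f g
    rw [L2.inner_def, L2.inner_def]
    refine integral_congr_ae ?_
    filter_upwards [S.adjoint.coeFn_compLpL f, S.coeFn_compLpL g] with t h h'
    rw [h, h', S.adjoint_inner_left]

theorem coeFn_liftL2 (S : H →L[ℂ] H) (f : Lp H 2 μ) : liftL2 μ S f =ᵐ[μ] fun t => S (f t) :=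
  S.coeFn_compLpL f

theorem liftL2_toLp (S : H →L[ℂ] H) {f : α → H} (hf : MemLp f 2 μ) :
    liftL2 μ S (hf.toLp f) = (S.comp_memLp' hf).toLp (S ∘ f) := by
  apply Lp.ext
  filter_upwards [coeFn_liftL2 S (hf.toLp f), hf.coeFn_toLp, (S.comp_memLp' hf).coeFn_toLp]
    with t h h' h''
  rw [h, h', h'', Function.comp_apply]

theorem norm_liftL2_apply_le (S : H →L[ℂ] H) (f : Lp H 2 μ) : ‖liftL2 μ S f‖ ≤ ‖S‖ * ‖f‖ :=
  S.norm_compLp_le f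

end Lift

section Intermediate

variable {H : Type*} [NormedAddCommGroup H] [InnerProductSpace ℂ H] {κ : ℝ}

theorem ae_eq_weightedMeasure_iff (κ : ℝ) {β : Type*} {f g : ℝ → β} :
    f =ᵐ[weightedMeasure κ] g ↔ f =ᵐ[volume.restrict (Ioi 0)] g := by
  rw [Filter.EventuallyEq, ae_weightedMeasure, Filter.EventuallyEq]

theorem locallyIntegrableOn_of_memLp {E : Type*} [NormedAddCommGroup E] {f : ℝ → E}
    (hf : MemLp f 2 (weightedMeasure κ)) : LocallyIntegrableOn f (Ioi 0) :=
  locallyIntegrableOn_Ioi_zero_iff.mpr fun a b ha hab =>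
    (intervalIntegrable_indicator_of_memLp one_le_two hf a b).congr fun _ ht =>
      indicator_of_mem (ha.trans (uIoc_of_le hab ▸ ht).1) f

theorem norm_pow4_add_norm_deriv4_le {A : H →ₗ.[ℂ] H} (u : W4 A κ) :
    ‖pow4 u‖ + ‖deriv4 u‖ ≤ 2 * W4norm u := by
  have hpow : ‖pow4 u‖ ≤ W4norm u := Real.le_sqrt_of_sq_le (by linarith [sq_nonneg ‖deriv4 u‖])
  have hderiv : ‖deriv4 u‖ ≤ W4norm u := Real.le_sqrt_of_sq_le (by linarith [sq_nonneg ‖pow4 u‖])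
  linarith

variable [CompleteSpace H]

theorem HasZeroTrace.apply_zero_eq_zero {s : ℕ} {u d : ℝ → H} (h : HasZeroTrace s u)
    (hd : HasWeakDeriv s u d) (hc : Continuous d) : d 0 = 0 := by
  obtain ⟨g, hg, hgc, hg0⟩ := h
  have hdg := hd.unique hg
  rw [restrict_Ioi_eq_restrict_Ici] at hdg
  rw [← hg0]
  exact Measure.eqOn_of_ae_eq hdg hc.continuousOn hgc (by rw [interior_Ici, closure_Ioi])
    self_mem_Ici

theorem HasWeakDeriv.exists_derivatives_memLp {n : ℕ} {u v : L2w H κ} (h : HasWeakDeriv n u v) :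
    ∃ d : ℕ → ℝ → H, d 0 =ᵐ[weightedMeasure κ] u ∧ d n =ᵐ[weightedMeasure κ] v ∧
      (∀ k < n, IsPrimitive (d k) (d (k + 1))) ∧
      ∀ k ≤ n, HasWeakDeriv k u (d k) ∧ MemLp (d k) 2 (weightedMeasure κ) := by
  have hv : (Ioi (0 : ℝ)).indicator v =ᵐ[weightedMeasure κ] v :=
    (ae_eq_weightedMeasure_iff κ).mpr (indicator_ae_eq_restrict measurableSet_Ioi)
  obtain ⟨d, hdn, hp, hw⟩ :=
    (h.congr (ae_eq_refl _) ((ae_eq_weightedMeasure_iff κ).mp hv.symm)).exists_derivatives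
      (intervalIntegrable_indicator_of_memLp one_le_two (Lp.memLp v))
  refine ⟨d, ?_, hdn ▸ hv, hp, fun k hk => ⟨hw k hk, ?_⟩⟩
  · exact (ae_eq_weightedMeasure_iff κ).mpr ((hw 0 n.zero_le).unique
      (hasWeakDeriv_zero_self (locallyIntegrableOn_of_memLp (Lp.memLp u))))
  · refine memLp_derivatives (Lp.stronglyMeasurable u) (Lp.memLp u) ?_ ?_ hp hw hk
    · exact hdn ▸ (Lp.stronglyMeasurable v).indicator measurableSet_Ioi
    · exact hdn ▸ (Lp.memLp v).ae_eq hv.symm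

theorem HasWeakDeriv.exists_pow_apply_eq {n : ℕ} {T : H →L[ℂ] H} (hT : 0 ≤ T) {u v w : L2w H κ}
    (hv : HasWeakDeriv n u v) (hw : u = liftL2 _ (T ^ n) w)
    (h0 : ∀ s, s + 1 < n → HasZeroTrace s u) {k : ℕ} (hk : k ≤ n) :
    ∃ y : L2w H κ, HasWeakDeriv k u (fun t => (T ^ (n - k)) (y t)) ∧
      ‖y‖ ≤ interpConst n (|κ| * (‖liftL2 (weightedMeasure κ) T‖ + 1)) * (‖w‖ + ‖v‖) := by
  obtain ⟨d, hd0, hdn, hp, hd⟩ := hv.exists_derivatives_memLp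
  let U : ℕ → L2w H κ := fun k => if hk : k ≤ n then (hd k hk).2.toLp (d k) else 0
  have hU : ∀ k (hk : k ≤ n), U k = (hd k hk).2.toLp (d k) := fun k hk => dif_pos hk
  have hUd : ∀ k ≤ n, U k =ᵐ[weightedMeasure κ] d k := fun k hk => by
    rw [hU k hk]; exact (hd k hk).2.coeFn_toLp
  have hU0 : U 0 = (liftL2 _ T ^ n) w := by
    rw [← map_pow, ← hw]
    exact Lp.ext ((hUd 0 n.zero_le).trans hd0)
  have hUn : U n = v := Lp.ext ((hUd n le_rfl).trans hdn)
  have henergy : ∀ ε : ℝ, 0 < ε → ∀ k, k + 2 ≤ n → ∀ m,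
      inner ℂ (U (k + 1)) ((regInverse (liftL2 _ T) ε ^ m) (U (k + 1))) +
          inner ℂ (U k) ((regInverse (liftL2 _ T) ε ^ m) (U (k + 2))) =
        κ * inner ℂ (U k) ((regInverse (liftL2 _ T) ε ^ m) (U (k + 1))) := by
    intro ε hε k hk m
    rw [← map_regInverse (liftL2 _) hT hε, ← map_pow, hU k (by omega), hU (k + 1) (by omega),
      hU (k + 2) hk, liftL2_toLp, liftL2_toLp]
    exact inner_toLp_add_inner_toLp_eq_of_isPrimitive (hp k (by omega))
      ((h0 k hk).apply_zero_eq_zero (hd k (by omega)).1 (hp k (by omega)).continuous)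
      ((hp (k + 1) hk).clm_comp ((regInverse T ε ^ m).restrictScalars ℝ)) _ _ _ _
  obtain ⟨y, hy, hyn⟩ :=
    exists_pow_apply_eq_of_energy_identity (map_nonneg (liftL2 _) hT) hU0 henergy hk
  refine ⟨y, (hd k hk).1.congr (ae_eq_refl _) ((ae_eq_weightedMeasure_iff κ).mp ?_), hUn ▸ hyn⟩
  rw [← map_pow] at hy
  exact (hUd k hk).symm.trans (hy ▸ coeFn_liftL2 _ y)

theorem eq_of_hasWeakDeriv_comp {k : ℕ} {u : ℝ → H} {S : H →L[ℂ] H} (hS : Function.Injective S)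
    {y y' : L2w H κ} (h : HasWeakDeriv k u fun t => S (y t))
    (h' : HasWeakDeriv k u fun t => S (y' t)) : y = y' := by
  apply Lp.ext
  filter_upwards [(ae_eq_weightedMeasure_iff κ).mpr (h.unique h')] with t ht
  exact hS ht

theorem exists_linearMap_of_hasWeakDeriv_comp {V : Type*} [AddCommGroup V] [Module ℂ V]
    (ι : V →ₗ[ℂ] L2w H κ) {k : ℕ} {S : H →L[ℂ] H} (hS : Function.Injective S)
    {N : V → ℝ} (h : ∀ x, ∃ y : L2w H κ, HasWeakDeriv k (ι x) (fun t => S (y t)) ∧ ‖y‖ ≤ N x) :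
    ∃ Y : V →ₗ[ℂ] L2w H κ, ∀ x, HasWeakDeriv k (ι x) (fun t => S (Y x t)) ∧ ‖Y x‖ ≤ N x := by
  choose Y hY hYN using h
  refine ⟨⟨⟨Y, fun x x' => ?_⟩, fun c x => ?_⟩, fun x => ⟨hY x, hYN x⟩⟩
  · refine eq_of_hasWeakDeriv_comp hS (hY _) (((hY x).add (hY x')).congr
      ((ae_eq_weightedMeasure_iff κ).mp ?_) ((ae_eq_weightedMeasure_iff κ).mp ?_))
    · rw [map_add]; exact (Lp.coeFn_add _ _).symm
    · filter_upwards [Lp.coeFn_add (Y x) (Y x')] with t ht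
      rw [ht, Pi.add_apply, Pi.add_apply, map_add]
  · refine eq_of_hasWeakDeriv_comp hS (hY _) (((hY x).smul c).congr
      ((ae_eq_weightedMeasure_iff κ).mp ?_) ((ae_eq_weightedMeasure_iff κ).mp ?_))
    · rw [map_smul]; exact (Lp.coeFn_smul _ _).symm
    · filter_upwards [Lp.coeFn_smul c (Y x)] with t ht
      rw [RingHom.id_apply, ht, Pi.smul_apply, Pi.smul_apply, map_smul]

theorem exists_hasWeakDeriv_pow_inverse {A : H →ₗ.[ℂ] H} {T : H →L[ℂ] H}
    (hTA : IsBoundedInverse A T) (hT : 0 ≤ T) {u : L2w H κ} (hu : u ∈ W4Zero A κ) {j : ℕ}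
    (hj : j ≤ 4) : ∃ y : L2w H κ, HasWeakDeriv (4 - j) u (fun t => (T ^ j) (y t)) ∧
      ‖y‖ ≤ interpConst 4 (|κ| * (‖liftL2 (weightedMeasure κ) T‖ + 1)) * 2 *
        W4norm (⟨u, hu.1⟩ : W4 A κ) := by
  let u' : W4 A κ := ⟨u, hu.1⟩
  have hpow : u = liftL2 _ (T ^ 4) (pow4 u') := by
    apply Lp.ext
    filter_upwards [coeFn_liftL2 (T ^ 4) (pow4 u'), u'.2.2.choose_spec] with t ht hgraph
    rw [ht]
    exact ((hTA.pow 4 _ _).mp hgraph).symm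
  obtain ⟨y, hy, hyn⟩ := HasWeakDeriv.exists_pow_apply_eq hT (v := deriv4 u')
    u'.2.1.choose_spec hpow (fun s hs => hu.2 s (by omega)) (Nat.sub_le 4 j)
  rw [Nat.sub_sub_self hj] at hy
  refine ⟨y, hy, hyn.trans ?_⟩
  rw [mul_assoc]
  exact mul_le_mul_of_nonneg_left (norm_pow4_add_norm_deriv4_le u')
    (interpConst_nonneg 4 (by positivity))

theorem exists_linearMap_hasWeakDeriv_pow_inverse {A : H →ₗ.[ℂ] H} {T : H →L[ℂ] H}
    (hTA : IsBoundedInverse A T) (hT : 0 ≤ T) (κ : ℝ) :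
    ∃ C, ∀ j ∈ Finset.Icc 1 4, ∃ Y : W4Zero A κ →ₗ[ℂ] L2w H κ, ∀ u : W4Zero A κ,
      HasWeakDeriv (4 - j) (u : L2w H κ) (fun t => (T ^ j) (Y u t)) ∧
      ‖Y u‖ ≤ C * W4norm (⟨u, u.2.1⟩ : W4 A κ) :=
  ⟨_, fun j hj => exists_linearMap_of_hasWeakDeriv_comp (W4Zero A κ).subtype
    (hTA.pow j).injective fun u =>
      exists_hasWeakDeriv_pow_inverse hTA hT u.2 (Finset.mem_Icc.mp hj).2⟩

theorem isPerturbation_sum {B : ℕ → (H →ₗ.[ℂ] H)} {T : H →L[ℂ] H} {Q : ℕ → (H →L[ℂ] H)}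
    (hQ : ∀ j ∈ Finset.Icc 1 4, ∀ y, ((T ^ j) y, Q j y) ∈ (B j).graph)
    {u : ℝ → H} {y : ℕ → L2w H κ}
    (hy : ∀ j ∈ Finset.Icc 1 4, HasWeakDeriv (4 - j) u fun t => (T ^ j) (y j t)) :
    IsPerturbation B κ u (∑ j ∈ Finset.Icc 1 4, liftL2 _ (Q j) (y j) : L2w H κ) := by
  refine ⟨fun k t => (T ^ (4 - k)) (y (4 - k) t), fun k hk => ?_, ?_⟩
  · have hk' := hy (4 - k) (Finset.mem_Icc.mpr (by omega))
    rwa [Nat.sub_sub_self hk.le] at hk'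
  · have hlift : ∀ᵐ t ∂(weightedMeasure κ), ∀ j ∈ Finset.Icc 1 4,
        liftL2 _ (Q j) (y j) t = Q j (y j t) :=
      (Filter.eventually_all_finset _).mpr fun j _ => coeFn_liftL2 (Q j) (y j)
    filter_upwards [hlift, Lp.coeFn_fun_finsetSum (Finset.Icc 1 4) fun j =>
      liftL2 (weightedMeasure κ) (Q j) (y j)] with t ht hsum
    refine ⟨fun j => Q j (y j t), fun j hj => ?_, hsum.trans (Finset.sum_congr rfl ht)⟩
    rw [Nat.sub_sub_self (Finset.mem_Icc.mp hj).2]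
    exact hQ j hj _

end Intermediate

end WeightedSobolev

end

theorem mainTheorem3_general {H : Type*} [NormedAddCommGroup H] [InnerProductSpace ℂ H]
    [CompleteSpace H]
    (A : H →ₗ.[ℂ] H) (hA : IsSelfAdjoint A)
    (lam : ℝ) (hlam : 0 < lam)
    (hpos : ∀ x : A.domain, lam * ‖(x : H)‖ ^ 2 ≤ (inner ℂ (A x) (x : H)).re)
    (κ : ℝ) (B : ℕ → (H →ₗ.[ℂ] H))
    (hB : ∀ j ∈ Finset.Icc 1 4, WeightedSobolev.IsBoundedIn
      (WeightedSobolev.opComp (B j) (WeightedSobolev.opPow A j).inverse)) :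
    ∃ P₁ : WeightedSobolev.W4Zero A κ →ₗ[ℂ] WeightedSobolev.L2w H κ,
      (∀ u : WeightedSobolev.W4Zero A κ,
        WeightedSobolev.IsPerturbation B κ (u : WeightedSobolev.L2w H κ) (P₁ u)) ∧
      ∃ C : ℝ, ∀ u : WeightedSobolev.W4Zero A κ,
        ‖P₁ u‖ ≤ C * WeightedSobolev.W4norm
          (⟨(u : WeightedSobolev.L2w H κ), u.2.1⟩ : WeightedSobolev.W4 A κ) := by
  obtain ⟨T, hTA⟩ := WeightedSobolev.exists_isBoundedInverse_of_coercive hA hlam hpos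
  have hT : 0 ≤ T := (ContinuousLinearMap.nonneg_iff_isPositive T).mpr
    (hTA.isPositive hA fun x => (by positivity : 0 ≤ lam * ‖(x : H)‖ ^ 2).trans (hpos x))
  obtain ⟨C, hC⟩ := WeightedSobolev.exists_linearMap_hasWeakDeriv_pow_inverse hTA hT κ
  choose! Y hYd hYn using fun j hj => hC j hj
  choose! Q hQ using fun j hj => (hTA.pow j).exists_mem_graph (hB j hj)
  refine ⟨∑ j ∈ Finset.Icc 1 4,
    (WeightedSobolev.liftL2 (WeightedSobolev.weightedMeasure κ) (Q j)).toLinearMap ∘ₗ Y j,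
    fun u => ?_, ∑ j ∈ Finset.Icc 1 4, ‖Q j‖ * C, fun u => ?_⟩ <;>
    simp only [LinearMap.sum_apply, LinearMap.comp_apply, ContinuousLinearMap.coe_coe]
  · exact WeightedSobolev.isPerturbation_sum hQ fun j hj => hYd j hj u
  · rw [Finset.sum_mul]
    refine (norm_sum_le _ _).trans (Finset.sum_le_sum fun j hj => ?_)
    rw [mul_assoc]
    exact (WeightedSobolev.norm_liftL2_apply_le (Q j) (Y j u)).trans
      (mul_le_mul_of_nonneg_left (hYn j hj u) (norm_nonneg _))

theorem mainTheorem3 {H : Type*} [NormedAddCommGroup H] [InnerProductSpace ℂ H] [CompleteSpace H]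
    [TopologicalSpace.SeparableSpace H]
    (A : H →ₗ.[ℂ] H) (hA : IsSelfAdjoint A)
    (lam : ℝ) (hlam : 0 < lam)
    (hpos : ∀ x : A.domain, lam * ‖(x : H)‖ ^ 2 ≤ (inner ℂ (A x) (x : H)).re)
    (κ : ℝ) (B : ℕ → (H →ₗ.[ℂ] H))
    (hB : ∀ j ∈ Finset.Icc 1 4, WeightedSobolev.IsBoundedIn
      (WeightedSobolev.opComp (B j) (WeightedSobolev.opPow A j).inverse)) :
    ∃ P₁ : WeightedSobolev.W4Zero A κ →ₗ[ℂ] WeightedSobolev.L2w H κ,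
      (∀ u : WeightedSobolev.W4Zero A κ,
        WeightedSobolev.IsPerturbation B κ (u : WeightedSobolev.L2w H κ) (P₁ u)) ∧
      ∃ C : ℝ, ∀ u : WeightedSobolev.W4Zero A κ,
        ‖P₁ u‖ ≤ C * WeightedSobolev.W4norm
          (⟨(u : WeightedSobolev.L2w H κ), u.2.1⟩ : WeightedSobolev.W4 A κ) :=
  mainTheorem3_general A hA lam hlam hpos κ B hB
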